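/- Let $n\ge 1$, let $\alpha_1,\dots,\alpha_n\in(0,\pi)$ be the angles and $\ell_1,\dots,\ell_n>0$ the side lengths of a curvilinear polygon $\mathcal P$: the side $I_j$ of length $\ell_j$ joins the vertices $V_{j-1}$ and $V_j$, the angle at $V_j$ is $\alpha_j$, and indices are cyclic modulo $n$. An angle is called exceptional if it equals $\pi/(2k)$ for some integer $k\ge1$; its parity is then $\mathcal O(\alpha)=\cos\frac{\pi^2}{2\alpha}=(-1)^k$. *Quasi-eigenvalues.* For $\sigma\in\mathbb R$ put $$\mathtt A(\alpha)=\begin{pmatrix}\csc\frac{\pi^2}{2\alpha}&-\mathrm i\cot\frac{\pi^2}{2\alpha}\\ \mathrm i\cot\frac{\pi^2}{2\alpha}&\csc\frac{\pi^2}{2\alpha}\end{pmatrix}\ (\alpha\text{ not exceptional}),\qquad \mathtt B(\ell,\sigma)=\begin{pmatrix}\mathrm e^{\mathrm i\ell\sigma}&0\\0&\mathrm e^{-\mathrm i\ell\sigma}\end{pmatrix}.$$ (a) If no angle is exceptional, let $\mathtt T(\sigma)=\mathtt A(\alpha_n)\mathtt B(\ell_n,\sigma)\cdots\mathtt A(\alpha_1)\mathtt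 B(\ell_1,\sigma)$. A number $\sigma\ge0$ is a quasi-eigenvalue if $1$ is an eigenvalue of $\mathtt T(\sigma)$. Its multiplicity is the geometric multiplicity of this eigenvalue if $\sigma>0$, and is one if $\sigma=0$. (b) If there are exceptional angles, they split the boundary into exceptional components. Each of them goes, in the direction of increasing index, from an exceptional vertex $V_s$ along the sides $I_{s+1},\dots,I_{s+m}$ to the next exceptional vertex $V_{s+m}$, $m\ge1$ (possibly $V_{s+m}=V_s$ with $m=n$). Let $\mathbf X(\alpha)=\frac1{\sqrt2}\binom{\mathrm e^{-\mathrm i\pi/4}}{\mathrm e^{\mathrm i\pi/4}}$ if $\mathcal O(\alpha)=1$ and $\mathbf X(\alpha)=\frac1{\sqrt2}\binom{\mathrm e^{\mathrm i\pi/4}}{\mathrm e^{-\mathrm i\pi/4}}$ if $\mathcal O(\alpha)=-1$, and let $\mathtt U_s(\sigma)=\mathtt B(\ell_{s+m},\sigma)\mathtt A(\alpha_{s+m-1})\mathtt B(\ell_{s+m-1},\sigma)\cdots\mathtt A(\alpha_{s+1})\mathtt B(\ell_{s+1},\sigma)$. A number $\sigma\ge0$ is a quasi-eigenvalue if $$\mathtt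 U_s(\sigma)\mathbf X(\alpha_s)\cdot\mathbf X(\alpha_{s+m})=0\qquad(u\cdot v=u_1\overline{v_1}+u_2\overline{v_2})$$ for at least one exceptional component. Its multiplicity is the number of components for which this holds if $\sigma>0$, and is half the number of components whose two end vertices have different parities if $\sigma=0$. *Quantum graph.* Let $\mathcal G$ be the cyclic metric graph with the vertices $V_j$ and the edges $I_j$, with arc length $s$ increasing from $V_{j-1}$ to $V_j$ on $I_j$. Let $\Delta_{\mathcal G}$ be the operator $f\mapsto-\frac{\mathrm d^2f}{\mathrm ds^2}$ in $L^2(\mathcal G)$ whose domain consists of the functions that are in $H^2$ on every edge and satisfy, for $j=1,\dots,n$, the matching conditions $$\sin\Bigl(\tfrac{\pi^2}{4\alpha_j}\Bigr)f|_{V_j+0}=\cos\Bigl(\tfrac{\pi^2}{4\alpha_j}\Bigr)f|_{V_j-0},\qquad \cos\Bigl(\tfrac{\pi^2}{4\alpha_j}\Bigr)f'|_{V_j+0}=\sin\Bigl(\tfrac{\pi^2}{4\alpha_j}\Bigr)f'|_{V_j-0},$$ where $V_j-0$ and $V_j+0$ denote the limits at $V_j$ along $I_j$ and along $I_{j+1}$,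 respectively. **Theorem.** The quasi-eigenvalues of $\mathcal P$, repeated according to multiplicity, form an infinite non-decreasing sequence $\sigma_1\le\sigma_2\le\cdots$; the eigenvalues of $\Delta_{\mathcal G}$ are real and, repeated according to multiplicity, form an infinite non-decreasing sequence $\nu_1\le\nu_2\le\cdots\to+\infty$; and $\sigma_m^2=\nu_m$ for all $m\ge1$. -/

import Mathlib

open MeasureTheory Matrix

noncomputable section

namespace SteklovPolygon

/-! ### Angles, transfer matrices -/

/-- An angle is exceptional if it equals `π / (2k)` for some integer `k ≥ 1`. -/
def IsExceptional (a : ℝ) : Prop := ∃ k : ℕ, 1 ≤ k ∧ a = Real.pi / (2 * k)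

/-- `μ_α = π² / (2α)`. -/
def angleMu (a : ℝ) : ℝ := Real.pi ^ 2 / (2 * a)

/-- The parity `cos (π² / (2α))` of an exceptional angle: `(-1)^k` if `α = π / (2k)`. -/
def parity (a : ℝ) : ℝ := Real.cos (angleMu a)

/-- The vertex transfer matrix of a non-exceptional angle
(never used below at exceptional angles, where its entries blow up). -/
def vertexMatrix (a : ℝ) : Matrix (Fin 2) (Fin 2) ℂ :=
  let a₁ : ℂ := ((1 / Real.sin (angleMu a) : ℝ) : ℂ)
  let a₂ : ℂ := ((Real.cos (angleMu a) / Real.sin (angleMu a) : ℝ) : ℂ)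
  !![a₁, -Complex.I * a₂; Complex.I * a₂, a₁]

/-- The side transfer matrix of a side of length `l`. -/
def sideMatrix (l σ : ℝ) : Matrix (Fin 2) (Fin 2) ℂ :=
  !![Complex.exp (Complex.I * l * σ), 0; 0, Complex.exp (-(Complex.I * l * σ))]

/-- `T = A(α_n) B(ℓ_n) ⋯ A(α_1) B(ℓ_1)`; the indices `1, …, n` are the elements of `Fin n`. -/
def polygonMatrix {n : ℕ} (α ℓ : Fin n → ℝ) (σ : ℝ) : Matrix (Fin 2) (Fin 2) ℂ :=
  (List.ofFn fun j : Fin n => vertexMatrix (α j) * sideMatrix (ℓ j) σ).reverse.prod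

/-! ### Exceptional boundary components -/

def xEven : Fin 2 → ℂ :=
  (1 / (Real.sqrt 2 : ℂ)) •
    ![Complex.exp (-(Complex.I * Real.pi / 4)), Complex.exp (Complex.I * Real.pi / 4)]

def xOdd : Fin 2 → ℂ :=
  (1 / (Real.sqrt 2 : ℂ)) •
    ![Complex.exp (Complex.I * Real.pi / 4), Complex.exp (-(Complex.I * Real.pi / 4))]

open Classical in
/-- The vector attached to an exceptional angle (whose parity is `1` or `-1`). -/
def xVec (a : ℝ) : Fin 2 → ℂ := if parity a = 1 then xEven else xOdd

/-- The vertex (or side) reached from the index `s` after `m` steps around the polygon. -/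
def step {n : ℕ} [NeZero n] (s : Fin n) (m : ℕ) : Fin n := s + Fin.ofNat n m

/-- For an exceptional vertex `s`, the number of sides of the exceptional component that starts
at `s`: the least `m ≥ 1` such that the vertex `m` steps after `s` is exceptional. Since one
returns to `s` after `n` steps, such an `m` exists and is at most `n`. -/
def compSize {n : ℕ} [NeZero n] (α : Fin n → ℝ) (s : Fin n) : ℕ :=
  sInf {m : ℕ | 1 ≤ m ∧ IsExceptional (α (step s m))}

/-- The exceptional vertex at which the exceptional component starting at `s` ends. -/
def nextExceptional {n : ℕ} [NeZero n] (α : Fin n → ℝ) (s : Fin n) : Fin n :=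
  step s (compSize α s)

/-- The transfer matrix along the `m + 1` sides `s+1, …, s+m+1` and through the `m` vertices
between them: `B(ℓ_{s+m+1}) A(α_{s+m}) B(ℓ_{s+m}) ⋯ A(α_{s+1}) B(ℓ_{s+1})`. -/
def pathMatrix {n : ℕ} [NeZero n] (α ℓ : Fin n → ℝ) (σ : ℝ) (s : Fin n) :
    ℕ → Matrix (Fin 2) (Fin 2) ℂ
  | 0 => sideMatrix (ℓ (step s 1)) σ
  | m + 1 => sideMatrix (ℓ (step s (m + 2))) σ * vertexMatrix (α (step s (m + 1))) *
      pathMatrix α ℓ σ s m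

/-- The matrix `U` of the exceptional component that starts at the exceptional vertex `s`. -/
def componentMatrix {n : ℕ} [NeZero n] (α ℓ : Fin n → ℝ) (σ : ℝ) (s : Fin n) :
    Matrix (Fin 2) (Fin 2) ℂ :=
  pathMatrix α ℓ σ s (compSize α s - 1)

/-- The quasi-eigenvalue equation `U X(start) · X(end) = 0` on the exceptional component that
starts at `s`; the dot product is the Hermitian one, `u · v = ∑ uᵢ conj vᵢ`. -/
def SolvesComponent {n : ℕ} [NeZero n] (α ℓ : Fin n → ℝ) (σ : ℝ) (s : Fin n) : Prop :=
  (componentMatrix α ℓ σ s *ᵥ xVec (α s)) ⬝ᵥ star (xVec (α (nextExceptional α s))) = 0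

/-! ### Quasi-eigenvalues and their multiplicities -/

open Classical in
/-- `σ` is a Steklov quasi-eigenvalue of the polygon with angles `α` and side lengths `ℓ`. -/
def IsQuasiEigenvalue {n : ℕ} [NeZero n] (α ℓ : Fin n → ℝ) (σ : ℝ) : Prop :=
  0 ≤ σ ∧
    if ∃ j, IsExceptional (α j) then
      ∃ s, IsExceptional (α s) ∧ SolvesComponent α ℓ σ s
    else
      Module.End.HasEigenvalue (Matrix.toLin' (polygonMatrix α ℓ σ)) 1

open Classical in
/-- The multiplicity of `σ` as a quasi-eigenvalue (`0` if `σ` is none). Exceptional components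
are indexed by the exceptional vertices at which they start; those whose two end vertices have
different parities (the odd ones) are even in number. -/
def quasiMultiplicity {n : ℕ} [NeZero n] (α ℓ : Fin n → ℝ) (σ : ℝ) : ℕ :=
  if IsQuasiEigenvalue α ℓ σ then
    if ∃ j, IsExceptional (α j) then
      if σ = 0 then
        {s : Fin n | IsExceptional (α s) ∧
          parity (α s) ≠ parity (α (nextExceptional α s))}.ncard / 2
      else
        {s : Fin n | IsExceptional (α s) ∧ SolvesComponent α ℓ σ s}.ncard
    else
      if σ = 0 then 1
      else Module.finrank ℂ (Module.End.eigenspace (Matrix.toLin' (polygonMatrix α ℓ σ)) 1)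
  else 0

/-- `σ 0 ≤ σ 1 ≤ …` lists the quasi-eigenvalues with multiplicities. -/
def IsQuasiEigenvalueSeq {n : ℕ} [NeZero n] (α ℓ : Fin n → ℝ) (σ : ℕ → ℝ) : Prop :=
  Monotone σ ∧ ∀ x : ℝ, {m | σ m = x}.encard = quasiMultiplicity α ℓ x

/-! ### The quantum graph Laplacian

The `j`-th edge, which joins the vertices `j - 1` and `j`, is parametrised by arc length over
`[0, ℓ j]`, so that `0` corresponds to the right side `V_{j-1} + 0` of the vertex `j - 1` and
`ℓ j` to the left side `V_j - 0` of the vertex `j`. -/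

/-- The Hilbert space `L²(𝒢) = ⨁ L²(0, ℓ j)`. -/
abbrev GraphL2 {n : ℕ} (ℓ : Fin n → ℝ) : Type :=
  PiLp 2 fun j : Fin n => Lp ℂ 2 (volume.restrict (Set.Ioo 0 (ℓ j)))

/-- `f` is the absolutely continuous representative on `[0, L]` of a function in `H¹(0, L)`
whose derivative is `g ∈ L²(0, L)`. -/
def IsH1 (L : ℝ) (f g : ℝ → ℂ) : Prop :=
  MemLp g 2 (volume.restrict (Set.Ioo 0 L)) ∧
    ∀ x ∈ Set.Icc 0 L, f x = f 0 + ∫ t in (0 : ℝ)..x, g t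

/-- The matching conditions at the vertices, for a function `f` on the graph with edgewise
derivative `f'`. -/
def Matching {n : ℕ} [NeZero n] (α ℓ : Fin n → ℝ) (f f' : Fin n → ℝ → ℂ) : Prop :=
  ∀ j : Fin n,
    (Real.sin (Real.pi ^ 2 / (4 * α j)) : ℂ) * f (j + 1) 0 =
        (Real.cos (Real.pi ^ 2 / (4 * α j)) : ℂ) * f j (ℓ j) ∧
    (Real.cos (Real.pi ^ 2 / (4 * α j)) : ℂ) * f' (j + 1) 0 =
        (Real.sin (Real.pi ^ 2 / (4 * α j)) : ℂ) * f' j (ℓ j)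

/-- `u` belongs to the domain of the quantum graph Laplacian (it is in `H²` on every edge and
satisfies the matching conditions) and is mapped to `w = -u''`. -/
def LaplacianRel {n : ℕ} [NeZero n] (α ℓ : Fin n → ℝ) (u w : GraphL2 ℓ) : Prop :=
  ∃ f f' f'' : Fin n → ℝ → ℂ,
    (∀ j, IsH1 (ℓ j) (f j) (f' j) ∧ IsH1 (ℓ j) (f' j) (f'' j)) ∧
    Matching α ℓ f f' ∧
    ∀ j, (u j : ℝ → ℂ) =ᵐ[volume.restrict (Set.Ioo 0 (ℓ j))] f j ∧
      (w j : ℝ → ℂ) =ᵐ[volume.restrict (Set.Ioo 0 (ℓ j))] fun x => -f'' j x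

theorem IsH1.intervalIntegrable {L : ℝ} {f g : ℝ → ℂ} (h : IsH1 L f g) {x : ℝ}
    (hx : x ∈ Set.Icc 0 L) : IntervalIntegrable g volume 0 x := by
  have h1 : Integrable g (volume.restrict (Set.Ioo 0 L)) := h.1.integrable (by norm_num)
  rw [intervalIntegrable_iff_integrableOn_Ioo_of_le hx.1]
  exact IntegrableOn.mono_set h1 (Set.Ioo_subset_Ioo_right hx.2)

theorem IsH1.add {L : ℝ} {f g f₂ g₂ : ℝ → ℂ} (h : IsH1 L f g) (h₂ : IsH1 L f₂ g₂) :
    IsH1 L (f + f₂) (g + g₂) := by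
  refine ⟨h.1.add h₂.1, fun x hx => ?_⟩
  simp only [Pi.add_apply]
  rw [intervalIntegral.integral_add (h.intervalIntegrable hx) (h₂.intervalIntegrable hx),
    h.2 x hx, h₂.2 x hx]
  ring

theorem IsH1.smul {L : ℝ} {f g : ℝ → ℂ} (c : ℂ) (h : IsH1 L f g) :
    IsH1 L (c • f) (c • g) := by
  refine ⟨h.1.const_smul c, fun x hx => ?_⟩
  simp only [Pi.smul_apply]
  rw [intervalIntegral.integral_smul, h.2 x hx, smul_add]

/-- The graph of the quantum graph Laplacian. -/
def laplacianGraph {n : ℕ} [NeZero n] (α ℓ : Fin n → ℝ) :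
    Submodule ℂ (GraphL2 ℓ × GraphL2 ℓ) where
  carrier := {p | LaplacianRel α ℓ p.1 p.2}
  zero_mem' := by
    refine ⟨0, 0, 0, fun j => ⟨⟨?_, ?_⟩, ⟨?_, ?_⟩⟩, fun j => ?_, fun j => ⟨?_, ?_⟩⟩
    · exact MemLp.zero
    · simp
    · exact MemLp.zero
    · simp
    · simp
    · exact Lp.coeFn_zero _ _ _
    · filter_upwards [Lp.coeFn_zero ℂ 2 (volume.restrict (Set.Ioo 0 (ℓ j)))] with x hx
      simpa using hx
  add_mem' := by
    rintro p q ⟨f, f', f'', h, hm, hu⟩ ⟨g, g', g'', k, km, ku⟩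
    refine ⟨f + g, f' + g', f'' + g'', fun j => ⟨(h j).1.add (k j).1, (h j).2.add (k j).2⟩,
      fun j => ⟨?_, ?_⟩, fun j => ⟨?_, ?_⟩⟩
    · simp only [Pi.add_apply, mul_add, (hm j).1, (km j).1]
    · simp only [Pi.add_apply, mul_add, (hm j).2, (km j).2]
    · filter_upwards [Lp.coeFn_add (p.1 j) (q.1 j), (hu j).1, (ku j).1] with x h1 h2 h3
      simpa [h2, h3] using h1
    · filter_upwards [Lp.coeFn_add (p.2 j) (q.2 j), (hu j).2, (ku j).2] with x h1 h2 h3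
      simp only [Pi.add_apply, h2, h3] at h1
      simp only [Prod.snd_add, PiLp.add_apply, h1, Pi.add_apply]
      ring
  smul_mem' := by
    rintro c p ⟨f, f', f'', h, hm, hu⟩
    refine ⟨c • f, c • f', c • f'', fun j => ⟨(h j).1.smul c, (h j).2.smul c⟩,
      fun j => ⟨?_, ?_⟩, fun j => ⟨?_, ?_⟩⟩
    · simp only [Pi.smul_apply, mul_smul_comm, (hm j).1]
    · simp only [Pi.smul_apply, mul_smul_comm, (hm j).2]
    · filter_upwards [Lp.coeFn_smul c (p.1 j), (hu j).1] with x h1 h2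
      simpa [h2] using h1
    · filter_upwards [Lp.coeFn_smul c (p.2 j), (hu j).2] with x h1 h2
      simp only [Pi.smul_apply, h2] at h1
      simp only [Prod.smul_snd, PiLp.smul_apply, h1, Pi.smul_apply, smul_neg]

/-- The derivative of an `H¹` function that vanishes almost everywhere vanishes almost
everywhere. -/
theorem IsH1.ae_zero {L : ℝ} {f g : ℝ → ℂ} (h : IsH1 L f g)
    (hf : f =ᵐ[volume.restrict (Set.Ioo 0 L)] 0) :
    g =ᵐ[volume.restrict (Set.Ioo 0 L)] 0 := by
  rcases le_or_gt L 0 with hL | hL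
  · simp [Set.Ioo_eq_empty_of_le hL, Filter.EventuallyEq]
  have hint := h.intervalIntegrable (Set.right_mem_Icc.2 hL.le)
  have hc : ContinuousOn f (Set.Icc 0 L) := by
    have h1 := intervalIntegral.continuousOn_primitive_interval' hint Set.left_mem_uIcc
    rw [Set.uIcc_of_le hL.le] at h1
    exact (continuousOn_const.add h1).congr h.2
  have hz : Set.EqOn f 0 (Set.Ioo 0 L) :=
    Measure.eqOn_open_of_ae_eq hf isOpen_Ioo (hc.mono Set.Ioo_subset_Icc_self)
      continuousOn_const
  have hd := hint.ae_hasDerivAt_integral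
  rw [Filter.EventuallyEq, ae_restrict_iff' measurableSet_Ioo]
  filter_upwards [hd] with x hx hxm
  have hxI : x ∈ Set.uIcc 0 L := by
    rw [Set.uIcc_of_le hL.le]; exact Set.Ioo_subset_Icc_self hxm
  have h1 := hx hxI 0 Set.left_mem_uIcc
  have h2 : (fun y => ∫ t in (0 : ℝ)..y, g t) =ᶠ[nhds x] fun _ => -f 0 := by
    filter_upwards [isOpen_Ioo.mem_nhds hxm] with y hy
    have h3 := h.2 y (Set.Ioo_subset_Icc_self hy)
    rw [hz hy] at h3
    exact (neg_eq_of_add_eq_zero_right h3.symm).symm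
  exact h1.unique ((hasDerivAt_const x (-f 0)).congr_of_eventuallyEq h2)

/-- The quantum graph Laplacian `f ↦ -f''` as an unbounded operator in `L²(𝒢)`. -/
def graphLaplacian {n : ℕ} [NeZero n] (α ℓ : Fin n → ℝ) : GraphL2 ℓ →ₗ.[ℂ] GraphL2 ℓ :=
  (laplacianGraph α ℓ).toLinearPMap

/-- The relation `LaplacianRel` is single-valued, hence is exactly the graph of the operator. -/
theorem graphLaplacian_graph {n : ℕ} [NeZero n] (α ℓ : Fin n → ℝ) :
    (graphLaplacian α ℓ).graph = laplacianGraph α ℓ := by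
  apply Submodule.toLinearPMap_graph_eq
  rintro ⟨u, w⟩ ⟨f, f', f'', h, -, hu⟩ (rfl : u = 0)
  ext j
  have h0 : f j =ᵐ[volume.restrict (Set.Ioo 0 (ℓ j))] 0 :=
    (hu j).1.symm.trans (Lp.coeFn_zero _ _ _)
  filter_upwards [(h j).2.ae_zero ((h j).1.ae_zero h0), (hu j).2,
    Lp.coeFn_zero ℂ 2 (volume.restrict (Set.Ioo 0 (ℓ j)))] with x h1 h2 h3
  simp only [h2, h1, Pi.zero_apply, neg_zero]
  exact h3.symm

/-- The eigenspace `{u ∈ Dom T | T u = z u}` of an unbounded operator. -/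
def eigenspace {H : Type*} [AddCommGroup H] [Module ℂ H] (T : H →ₗ.[ℂ] H) (z : ℂ) :
    Submodule ℂ H :=
  T.graph.comap (LinearMap.id.prod (z • LinearMap.id))

/-- `ν 0 ≤ ν 1 ≤ …` lists all (complex) eigenvalues of `T` with their geometric multiplicities;
in particular all of them are real. -/
def IsEigenvalueSeq {H : Type*} [AddCommGroup H] [Module ℂ H] (T : H →ₗ.[ℂ] H)
    (ν : ℕ → ℝ) : Prop :=
  Monotone ν ∧
    ∀ z : ℂ, {m | (ν m : ℂ) = z}.encard = Cardinal.toENat (Module.rank ℂ (eigenspace T z))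

end SteklovPolygon

end

/-!
On an edge, a solution of `-f'' = σ² f` with `σ > 0` is a superposition of two waves, recorded by
an amplitude vector in `ℂ²`. The matrix `B (ℓ, σ)` moves this vector along a side, and the matching
conditions at a non-exceptional vertex are exactly multiplication by `A (α)`. At an exceptional
vertex they decouple into a Dirichlet condition on one side and a Neumann condition on the other,
which say that the amplitude vector is orthogonal to `X (α)` before the vertex and that it is a
multiple of `X (α)` after it. Hence the eigenspace of `σ²` is, up to isomorphism, the space of
solutions of a cyclic linear system, and its dimension is the multiplicity of `σ`. For `σ = 0`
integration by parts leaves only functions constant on the edges.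

There are infinitely many quasi-eigenvalues because a non-exceptional vertex lowers the phase of a
real wave by at most `π`, whereas each side advances it by `ℓ σ`; so the phase of a transported wave
grows without bound and takes, by continuity, the values that solve the quasi-eigenvalue equation.
They do not accumulate because that equation is analytic in `σ`. Two non-decreasing sequences that
take every value equally often coincide.
-/

noncomputable section

namespace SteklovPolygon

/-! ### Sequences with prescribed multiplicities -/

section Multiplicities

theorem nonempty_orderIso_nat {ι : Type*} [LinearOrder ι] [Nonempty ι] [NoMaxOrder ι]
    (hfin : ∀ i : ι, (Set.Iic i).Finite) : Nonempty (ι ≃o ℕ) := by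
  let _ : LocallyFiniteOrder ι :=
    LocallyFiniteOrder.ofFiniteIcc fun _ j => (hfin j).subset Set.Icc_subset_Iic_self
  let _ : SuccOrder ι := LinearLocallyFiniteOrder.succOrder ι
  let _ : PredOrder ι := LinearLocallyFiniteOrder.predOrder ι
  let i₀ : ι := Classical.arbitrary ι
  obtain ⟨b, hb, hmin⟩ := (hfin i₀).exists_minimal ⟨i₀, Set.self_mem_Iic⟩
  let _ : OrderBot ι :=
    { bot := b
      bot_le := fun i => (le_total b i).elim id fun hi => hmin (hi.trans hb) hi }
  exact ⟨orderIsoNatOfLinearSuccPredArch⟩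

variable {X : Type*}

/-- The index set of a listing of the points of `X` with multiplicities `μ`: the pairs `(x, k)`
with `k < μ x`, ordered lexicographically. -/
abbrev MultiplicityIndex (μ : X → ℕ) : Type _ :=
  {p : X ×ₗ ℕ // (ofLex p).2 < μ (ofLex p).1}

/-- The point of `X` that an index lists. -/
def MultiplicityIndex.point {μ : X → ℕ} (p : MultiplicityIndex μ) : X := (ofLex p.1).1

theorem MultiplicityIndex.encard_point_eq {μ : X → ℕ} (x : X) :
    {p : MultiplicityIndex μ | p.point = x}.encard = μ x := by
  let listing : Fin (μ x) → MultiplicityIndex μ := fun k => ⟨toLex (x, (k : ℕ)), k.2⟩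
  have hinj : Function.Injective listing := fun k k' h =>
    Fin.ext (congrArg (fun p : MultiplicityIndex μ => (ofLex p.1).2) h)
  have hrange : {p : MultiplicityIndex μ | p.point = x} = Set.range listing := by
    ext p
    constructor
    · rintro rfl
      exact ⟨⟨(ofLex p.1).2, p.2⟩, rfl⟩
    · rintro ⟨k, rfl⟩
      rfl
  rw [hrange, ← Set.image_univ, hinj.encard_image, Set.encard_univ, ENat.card_eq_coe_fintype_card,
    Fintype.card_fin]

theorem exists_injective_comp_eq_of_encard_le {a b : ℕ → X}
    (h : ∀ x, {m | a m = x}.encard ≤ {m | b m = x}.encard) :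
    ∃ g : ℕ → ℕ, Function.Injective g ∧ b ∘ g = a := by
  have hemb (x : X) : Nonempty ({m // a m = x} ↪ {m // b m = x}) :=
    (Cardinal.toENat_le_iff_of_le_aleph0 Cardinal.mk_le_aleph0).1 (h x)
  let f (x : X) := (hemb x).some
  let fiberwise : (Σ x, {m // a m = x}) → Σ x, {m // b m = x} := Sigma.map id fun x => f x
  have hf : Function.Injective fiberwise :=
    Function.injective_id.sigma_map fun x => (f x).injective
  refine ⟨Equiv.sigmaFiberEquiv b ∘ fiberwise ∘ (Equiv.sigmaFiberEquiv a).symm,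
    (Equiv.injective _).comp (hf.comp (Equiv.injective _)), funext fun m => ?_⟩
  exact (f (a m) ⟨m, rfl⟩).2

variable [LinearOrder X]

theorem MultiplicityIndex.monotone_point {μ : X → ℕ} :
    Monotone (MultiplicityIndex.point (μ := μ)) :=
  fun _ _ h => Prod.Lex.monotone_fst _ _ h

theorem MultiplicityIndex.finite_Iic {μ : X → ℕ} (hfin : ∀ R, {x | μ x ≠ 0 ∧ x ≤ R}.Finite)
    (q : MultiplicityIndex μ) : (Set.Iic q).Finite := by
  have hlex : (⋃ x ∈ {x | μ x ≠ 0 ∧ x ≤ q.point},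
      (fun k => toLex (x, k)) '' Set.Iio (μ x)).Finite :=
    (hfin _).biUnion fun x _ => (Set.finite_Iio _).image _
  refine (hlex.preimage Subtype.val_injective.injOn).subset fun p hp => ?_
  exact Set.mem_biUnion (x := point p) ⟨p.2.ne_bot, monotone_point hp⟩ ⟨(ofLex p.1).2, p.2, rfl⟩

theorem exists_monotone_encard_eq [Nonempty X] {μ : X → ℕ}
    (hfin : ∀ R, {x | μ x ≠ 0 ∧ x ≤ R}.Finite) (hinf : ∀ R, ∃ x > R, μ x ≠ 0) :
    ∃ σ : ℕ → X, Monotone σ ∧ (∀ x, {m | σ m = x}.encard = μ x) ∧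
      Filter.Tendsto σ Filter.atTop Filter.atTop := by
  have exists_point_gt (R : X) : ∃ p : MultiplicityIndex μ, R < p.point := by
    obtain ⟨x, hx, h⟩ := hinf R
    exact ⟨⟨toLex (x, 0), Nat.pos_of_ne_zero h⟩, hx⟩
  have : Nonempty (MultiplicityIndex μ) := (exists_point_gt (Classical.arbitrary X)).nonempty
  have : NoMaxOrder (MultiplicityIndex μ) :=
    ⟨fun p => (exists_point_gt p.point).imp fun _ hq => Prod.Lex.toLex_lt_toLex.2 (Or.inl hq)⟩
  obtain ⟨e⟩ := nonempty_orderIso_nat (MultiplicityIndex.finite_Iic hfin)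
  have hmono : Monotone fun m => (e.symm m).point :=
    MultiplicityIndex.monotone_point.comp e.symm.monotone
  refine ⟨_, hmono, fun x => ?_, Filter.tendsto_atTop_atTop_of_monotone hmono fun R => ?_⟩
  · rw [← MultiplicityIndex.encard_point_eq x]
    exact Set.encard_preimage_of_bijective e.symm.bijective {p | p.point = x}
  · obtain ⟨p, hp⟩ := exists_point_gt R
    exact ⟨e p, by simpa only [OrderIso.symm_apply_apply] using hp.le⟩

theorem le_of_monotone_of_encard_le {a b : ℕ → X} (ha : Monotone a) (hb : Monotone b)
    (h : ∀ x, {m | a m = x}.encard ≤ {m | b m = x}.encard) : b ≤ a := by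
  obtain ⟨g, hg, rfl⟩ := exists_injective_comp_eq_of_encard_le h
  intro m
  obtain ⟨k, hk, hmk⟩ : ∃ k ∈ Finset.range (m + 1), m ≤ g k := by
    by_contra! hlt
    have hcard := Finset.card_le_card_of_injOn g
      (fun k hk => Finset.mem_range.2 (hlt k hk)) hg.injOn
    simp only [Finset.card_range] at hcard
    omega
  calc b m ≤ b (g k) := hb hmk
    _ ≤ b (g m) := ha (Nat.lt_succ_iff.1 (Finset.mem_range.1 hk))

theorem eq_of_monotone_of_encard_eq {a b : ℕ → X} (ha : Monotone a) (hb : Monotone b)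
    (h : ∀ x, {m | a m = x}.encard = {m | b m = x}.encard) : a = b :=
  le_antisymm (le_of_monotone_of_encard_le hb ha fun x => (h x).ge)
    (le_of_monotone_of_encard_le ha hb fun x => (h x).le)

end Multiplicities

/-! ### Solutions of `-f'' = z f` on an edge -/

section Edge

variable {L : ℝ} {f g : ℝ → ℂ}

theorem IsH1.continuousOn (h : IsH1 L f g) : ContinuousOn f (Set.Icc 0 L) := by
  rcases lt_or_ge L 0 with hL | hL
  · simp only [Set.Icc_eq_empty hL.not_ge, continuousOn_empty]
  · have hprim := intervalIntegral.continuousOn_primitive_interval'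
      (h.intervalIntegrable (Set.right_mem_Icc.2 hL)) Set.left_mem_uIcc
    rw [Set.uIcc_of_le hL] at hprim
    exact (continuousOn_const.add hprim).congr h.2

theorem IsH1.congr_deriv {g₂ : ℝ → ℂ} (h : IsH1 L f g)
    (hg : g =ᵐ[volume.restrict (Set.Ioo 0 L)] g₂) : IsH1 L f g₂ := by
  refine ⟨(memLp_congr_ae hg).1 h.1, fun x hx => ?_⟩
  rw [h.2 x hx]
  congr 1
  rw [intervalIntegral.integral_of_le hx.1, intervalIntegral.integral_of_le hx.1,
    integral_Ioc_eq_integral_Ioo, integral_Ioc_eq_integral_Ioo]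
  exact integral_congr_ae (ae_restrict_of_ae_restrict_of_subset
    (Set.Ioo_subset_Ioo_right hx.2) hg)

theorem IsH1.hasDerivAt (h : IsH1 L f g) (hg : ContinuousOn g (Set.Icc 0 L)) {x : ℝ}
    (hx : x ∈ Set.Ioo 0 L) : HasDerivAt f (g x) x := by
  have hgo : ContinuousOn g (Set.Ioo 0 L) := hg.mono Set.Ioo_subset_Icc_self
  have hprim : HasDerivAt (fun y => ∫ t in (0 : ℝ)..y, g t) (g x) x :=
    intervalIntegral.integral_hasDerivAt_right
      (h.intervalIntegrable (Set.Ioo_subset_Icc_self hx))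
      (hgo.stronglyMeasurableAtFilter isOpen_Ioo x hx)
      (hgo.continuousAt (isOpen_Ioo.mem_nhds hx))
  refine (hprim.const_add (f 0)).congr_of_eventuallyEq ?_
  filter_upwards [isOpen_Ioo.mem_nhds hx] with y hy
  exact h.2 y (Set.Ioo_subset_Icc_self hy)

theorem IsH1.hasDerivWithinAt_Ici (h : IsH1 L f g) (hg : ContinuousOn g (Set.Icc 0 L)) {x : ℝ}
    (hx : x ∈ Set.Ico 0 L) : HasDerivWithinAt f (g x) (Set.Ici x) x := by
  have hxL : Set.Ioo x L ⊆ Set.Icc 0 L := Set.Ioo_subset_Icc_self.trans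
    (Set.Icc_subset_Icc_left hx.1)
  refine hasDerivWithinAt_Ici_of_tendsto_deriv (s := Set.Ioo x L)
    (fun y hy =>
      (h.hasDerivAt hg ⟨hx.1.trans_lt hy.1, hy.2⟩).differentiableAt.differentiableWithinAt)
    ((h.continuousOn x ⟨hx.1, hx.2.le⟩).mono hxL) (Ioo_mem_nhdsGT hx.2) ?_
  have hlim : Filter.Tendsto g (nhdsWithin x (Set.Ioo x L)) (nhds (g x)) :=
    (hg x ⟨hx.1, hx.2.le⟩).mono hxL
  rw [nhdsWithin_Ioo_eq_nhdsGT hx.2] at hlim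
  refine hlim.congr' ?_
  filter_upwards [Ioo_mem_nhdsGT hx.2] with y hy
  exact (h.hasDerivAt hg ⟨hx.1.trans_lt hy.1, hy.2⟩).deriv.symm

theorem IsH1.eqOn_of_initial_eq {z : ℂ} {f₁ g₁ f₂ g₂ : ℝ → ℂ}
    (hf₁ : IsH1 L f₁ g₁) (hg₁ : IsH1 L g₁ fun x => -(z * f₁ x))
    (hf₂ : IsH1 L f₂ g₂) (hg₂ : IsH1 L g₂ fun x => -(z * f₂ x))
    (hf : f₁ 0 = f₂ 0) (hg : g₁ 0 = g₂ 0) :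
    Set.EqOn (fun x => (f₁ x, g₁ x)) (fun x => (f₂ x, g₂ x)) (Set.Icc 0 L) := by
  let A : ℂ × ℂ →L[ℂ] ℂ × ℂ :=
    (ContinuousLinearMap.snd ℂ ℂ ℂ).prod (-(z • ContinuousLinearMap.fst ℂ ℂ ℂ))
  have solves {f g : ℝ → ℂ} (hf : IsH1 L f g) (hg : IsH1 L g fun x => -(z * f x)) (t : ℝ)
      (ht : t ∈ Set.Ico 0 L) :
      HasDerivWithinAt (fun x => (f x, g x)) (A (f t, g t)) (Set.Ici t) t :=
    (hf.hasDerivWithinAt_Ici hg.continuousOn ht).prodMk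
      (hg.hasDerivWithinAt_Ici (hf.continuousOn.const_mul z).neg ht)
  exact ODE_solution_unique (fun _ => A.lipschitz)
    (hf₁.continuousOn.prodMk hg₁.continuousOn) (solves hf₁ hg₁)
    (hf₂.continuousOn.prodMk hg₂.continuousOn) (solves hf₂ hg₂) (Prod.ext hf hg)

theorem memLp_Ioo_of_continuous {p : ENNReal} (hg : Continuous g) (a b : ℝ) :
    MemLp g p (volume.restrict (Set.Ioo a b)) := by
  obtain ⟨C, hC⟩ := isCompact_Icc.exists_bound_of_continuousOn (s := Set.Icc a b) hg.continuousOn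
  refine MemLp.of_bound hg.aestronglyMeasurable C ?_
  filter_upwards [ae_restrict_mem measurableSet_Ioo] with x hx
  exact hC x (Set.Ioo_subset_Icc_self hx)

theorem isH1_of_hasDerivAt (h : ∀ x, HasDerivAt f (g x) x) (hg : Continuous g) : IsH1 L f g := by
  refine ⟨memLp_Ioo_of_continuous hg 0 L, fun x _ => ?_⟩
  rw [intervalIntegral.integral_eq_sub_of_hasDerivAt (fun y _ => h y)
    (hg.intervalIntegrable _ _), add_sub_cancel]

theorem apply_zero_eq_zero_of_ae (hL : 0 < L) (hf : Continuous f)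
    (h : f =ᵐ[volume.restrict (Set.Ioo 0 L)] 0) : f 0 = 0 := by
  have hzero : Set.EqOn f 0 (Set.Icc 0 L) := by
    rw [← closure_Ioo hL.ne]
    exact (Measure.eqOn_open_of_ae_eq h isOpen_Ioo hf.continuousOn continuousOn_const).closure
      hf continuous_const
  exact hzero (Set.left_mem_Icc.2 hL.le)

theorem eqOn_zero_of_integral_norm_sq_eq_zero (hL : 0 < L) (hf : ContinuousOn f (Set.Icc 0 L))
    (h : ∫ x in (0 : ℝ)..L, ‖f x‖ ^ 2 = 0) : Set.EqOn f 0 (Set.Icc 0 L) := by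
  intro x hx
  by_contra hne
  have hfx : f x ≠ 0 := hne
  refine (intervalIntegral.integral_pos hL (f := fun x => ‖f x‖ ^ 2) (by fun_prop)
    (fun x _ => by positivity) ⟨x, hx, by positivity⟩).ne' h

theorem IsH1.integral_norm_sq_deriv_sub {z : ℂ} (hL : 0 ≤ L) (hf : IsH1 L f g)
    (hg : IsH1 L g fun x => -(z * f x)) :
    ((∫ x in (0 : ℝ)..L, ‖g x‖ ^ 2 : ℝ) : ℂ) - z * ((∫ x in (0 : ℝ)..L, ‖f x‖ ^ 2 : ℝ) : ℂ) =
      g L * star (f L) - g 0 * star (f 0) := by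
  have cf := hf.continuousOn
  have cg := hg.continuousOn
  have integrable_norm_sq {h : ℝ → ℂ} (ch : ContinuousOn h (Set.Icc 0 L)) :
      IntervalIntegrable (fun x => ((‖h x‖ ^ 2 : ℝ) : ℂ)) volume 0 L := by
    refine ContinuousOn.intervalIntegrable ?_
    rw [Set.uIcc_of_le hL]
    fun_prop
  have hint := (integrable_norm_sq cg).sub ((integrable_norm_sq cf).const_mul z)
  have hderiv (y : ℝ) : -(z * f y) * star (f y) + g y * star (g y) =
      ((‖g y‖ ^ 2 : ℝ) : ℂ) - z * ((‖f y‖ ^ 2 : ℝ) : ℂ) := by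
    simp only [Complex.ofReal_pow, ← Complex.mul_conj', Complex.star_def]
    ring
  rw [← intervalIntegral.integral_ofReal, ← intervalIntegral.integral_ofReal,
    ← intervalIntegral.integral_const_mul, ← intervalIntegral.integral_sub
      (integrable_norm_sq cg) ((integrable_norm_sq cf).const_mul z)]
  refine intervalIntegral.integral_eq_sub_of_hasDerivAt_of_le
    (f := fun x => g x * star (f x)) hL (cg.mul cf.star) (fun y hy => ?_) hint
  rw [← hderiv]
  exact (hg.hasDerivAt (by fun_prop) hy).mul (hf.hasDerivAt cg hy).star

/-- The solution `sin (σ x) / σ` of `-f'' = σ² f` with `f 0 = 0` and `f' 0 = 1`; it is `x` for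
`σ = 0`. -/
def sinOver (σ x : ℝ) : ℝ := if σ = 0 then x else Real.sin (σ * x) / σ

theorem sinOver_zero_left (x : ℝ) : sinOver 0 x = x := if_pos rfl

theorem sinOver_zero_right (σ : ℝ) : sinOver σ 0 = 0 := by simp [sinOver]

theorem mul_sinOver (σ x : ℝ) : σ * sinOver σ x = Real.sin (σ * x) := by
  by_cases h : σ = 0
  · simp [h]
  · rw [sinOver, if_neg h, mul_div_cancel₀ _ h]

theorem hasDerivAt_sinOver (σ x : ℝ) : HasDerivAt (sinOver σ) (Real.cos (σ * x)) x := by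
  by_cases h : σ = 0
  · subst h
    simpa [funext sinOver_zero_left] using hasDerivAt_id' x
  · have hsin : sinOver σ = fun x => Real.sin (σ * x) / σ := funext fun x => if_neg h
    rw [hsin]
    simpa [h] using (((hasDerivAt_id' x).const_mul σ).sin).div_const σ

theorem hasDerivAt_cos_mul (σ x : ℝ) :
    HasDerivAt (fun x => Real.cos (σ * x)) (-(σ ^ 2 * sinOver σ x)) x := by
  refine ((hasDerivAt_id' x).const_mul σ).cos.congr_deriv ?_
  rw [← mul_sinOver]
  ring

/-- The solution of `-f'' = σ² f` with `f 0 = v 0` and `f' 0 = v 1`. -/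
def edgeSol (σ : ℝ) (v : Fin 2 → ℂ) (x : ℝ) : ℂ := v 0 * Real.cos (σ * x) + v 1 * sinOver σ x

/-- The derivative of `edgeSol`. -/
def edgeSolDeriv (σ : ℝ) (v : Fin 2 → ℂ) (x : ℝ) : ℂ :=
  v 1 * Real.cos (σ * x) - v 0 * (σ ^ 2 * sinOver σ x)

variable (σ : ℝ) (v : Fin 2 → ℂ)

theorem hasDerivAt_edgeSol (x : ℝ) : HasDerivAt (edgeSol σ v) (edgeSolDeriv σ v x) x := by
  have hcos := ((hasDerivAt_cos_mul σ x).ofReal_comp).const_mul (v 0)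
  have hsin := ((hasDerivAt_sinOver σ x).ofReal_comp).const_mul (v 1)
  refine (hcos.add hsin).congr_deriv ?_
  simp only [edgeSolDeriv]
  push_cast
  ring

theorem hasDerivAt_edgeSolDeriv (x : ℝ) :
    HasDerivAt (edgeSolDeriv σ v) (-(σ ^ 2 * edgeSol σ v x)) x := by
  have hcos := ((hasDerivAt_cos_mul σ x).ofReal_comp).const_mul (v 1)
  have hsin := (((hasDerivAt_sinOver σ x).ofReal_comp).const_mul ((σ : ℂ) ^ 2)).const_mul (v 0)
  refine (hcos.sub hsin).congr_deriv ?_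
  simp only [edgeSol]
  push_cast
  ring

theorem continuous_edgeSol : Continuous (edgeSol σ v) :=
  continuous_iff_continuousAt.2 fun x => (hasDerivAt_edgeSol σ v x).continuousAt

theorem continuous_edgeSolDeriv : Continuous (edgeSolDeriv σ v) :=
  continuous_iff_continuousAt.2 fun x => (hasDerivAt_edgeSolDeriv σ v x).continuousAt

theorem isH1_edgeSol : IsH1 L (edgeSol σ v) (edgeSolDeriv σ v) :=
  isH1_of_hasDerivAt (hasDerivAt_edgeSol σ v) (continuous_edgeSolDeriv σ v)

theorem isH1_edgeSolDeriv : IsH1 L (edgeSolDeriv σ v) fun x => -(σ ^ 2 * edgeSol σ v x) :=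
  isH1_of_hasDerivAt (hasDerivAt_edgeSolDeriv σ v) ((continuous_edgeSol σ v).const_mul _).neg

theorem edgeSol_zero_right : edgeSol σ v 0 = v 0 := by
  simp [edgeSol, sinOver_zero_right]

theorem edgeSolDeriv_zero_right : edgeSolDeriv σ v 0 = v 1 := by
  simp [edgeSolDeriv, sinOver_zero_right]

variable {σ} {v}

theorem IsH1.eqOn_edgeSol (hf : IsH1 L f g) (hg : IsH1 L g fun x => -(σ ^ 2 * f x)) :
    Set.EqOn (fun x => (f x, g x))
      (fun x => (edgeSol σ ![f 0, g 0] x, edgeSolDeriv σ ![f 0, g 0] x)) (Set.Icc 0 L) :=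
  hf.eqOn_of_initial_eq hg (isH1_edgeSol σ _) (isH1_edgeSolDeriv σ _)
    (edgeSol_zero_right σ ![f 0, g 0]).symm (edgeSolDeriv_zero_right σ ![f 0, g 0]).symm

theorem eq_zero_of_edgeSol_ae_eq_zero (hL : 0 < L)
    (h : edgeSol σ v =ᵐ[volume.restrict (Set.Ioo 0 L)] 0) : v = 0 := by
  have hval := apply_zero_eq_zero_of_ae hL (continuous_edgeSol σ v) h
  have hslope := apply_zero_eq_zero_of_ae hL (continuous_edgeSolDeriv σ v)
    ((isH1_edgeSol σ v).ae_zero h)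
  rw [edgeSol_zero_right] at hval
  rw [edgeSolDeriv_zero_right] at hslope
  ext i
  fin_cases i
  exacts [hval, hslope]

end Edge

/-! ### Eigenspaces of the quantum graph Laplacian -/

/-- The number `π² / (4a)`, half of `angleMu a`, that enters the matching conditions. -/
def matchingAngle (a : ℝ) : ℝ := Real.pi ^ 2 / (4 * a)

/-- The matching conditions at one vertex of angle `a`, for the limits `f₁`, `f₁'` of a function
and its derivative at `V - 0` and their limits `f₂`, `f₂'` at `V + 0`. -/
def VertexMatching (a : ℝ) (f₁ f₁' f₂ f₂' : ℂ) : Prop :=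
  (Real.sin (matchingAngle a) : ℂ) * f₂ = (Real.cos (matchingAngle a) : ℂ) * f₁ ∧
    (Real.cos (matchingAngle a) : ℂ) * f₂' = (Real.sin (matchingAngle a) : ℂ) * f₁'

-- The boundary terms of an integration by parts cancel at the vertices.
theorem VertexMatching.mul_star_eq {a : ℝ} {f₁ f₁' f₂ f₂' : ℂ}
    (h : VertexMatching a f₁ f₁' f₂ f₂') : f₂' * star f₂ = f₁' * star f₁ := by
  obtain ⟨hval, hslope⟩ := h
  have hconj := congrArg star hval
  simp only [star_mul', Complex.star_def, Complex.conj_ofReal] at hconj ⊢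
  have hsc : (Real.sin (matchingAngle a) : ℂ) ^ 2 + (Real.cos (matchingAngle a) : ℂ) ^ 2 = 1 := by
    exact_mod_cast Real.sin_sq_add_cos_sq (matchingAngle a)
  set s : ℂ := (Real.sin (matchingAngle a) : ℂ)
  set c : ℂ := (Real.cos (matchingAngle a) : ℂ)
  linear_combination (f₁' * (starRingEnd ℂ) f₁ - f₂' * (starRingEnd ℂ) f₂) * hsc +
    (s * f₂' + c * f₁') * hconj + (s * (starRingEnd ℂ) f₁ + c * (starRingEnd ℂ) f₂) * hslope

section Eigenspaces

variable {n : ℕ}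

section

variable [NeZero n] {α ℓ : Fin n → ℝ}

theorem matching_iff {f f' : Fin n → ℝ → ℂ} : Matching α ℓ f f' ↔
    ∀ j, VertexMatching (α j) (f j (ℓ j)) (f' j (ℓ j)) (f (j + 1) 0) (f' (j + 1) 0) :=
  Iff.rfl

theorem mem_eigenspace_iff {z : ℂ} {u : GraphL2 ℓ} :
    u ∈ eigenspace (graphLaplacian α ℓ) z ↔ LaplacianRel α ℓ u (z • u) := by
  simp only [eigenspace, graphLaplacian_graph]
  rfl

theorem exists_rep_of_mem_eigenspace {z : ℂ} {u : GraphL2 ℓ}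
    (hu : u ∈ eigenspace (graphLaplacian α ℓ) z) :
    ∃ f f' : Fin n → ℝ → ℂ,
      (∀ j, IsH1 (ℓ j) (f j) (f' j) ∧ IsH1 (ℓ j) (f' j) fun x => -(z * f j x)) ∧
      Matching α ℓ f f' ∧
      ∀ j, (u j : ℝ → ℂ) =ᵐ[volume.restrict (Set.Ioo 0 (ℓ j))] f j := by
  obtain ⟨f, f', f'', h, hm, hf⟩ := mem_eigenspace_iff.1 hu
  refine ⟨f, f', fun j => ⟨(h j).1, (h j).2.congr_deriv ?_⟩, hm, fun j => (hf j).1⟩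
  filter_upwards [Lp.coeFn_smul z (u j), (hf j).1, (hf j).2] with x hsmul hux hzux
  have hz : ((z • u) j : ℝ → ℂ) x = z * u j x := hsmul
  rw [hz, hux] at hzux
  rw [hzux, neg_neg]

theorem energy_identity (hℓ : ∀ j, 0 ≤ ℓ j) {z : ℂ} {f f' : Fin n → ℝ → ℂ}
    (h : ∀ j, IsH1 (ℓ j) (f j) (f' j) ∧ IsH1 (ℓ j) (f' j) fun x => -(z * f j x))
    (hm : Matching α ℓ f f') :
    ((∑ j, ∫ x in (0 : ℝ)..ℓ j, ‖f' j x‖ ^ 2 : ℝ) : ℂ) =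
      z * ((∑ j, ∫ x in (0 : ℝ)..ℓ j, ‖f j x‖ ^ 2 : ℝ) : ℂ) := by
  have hcyclic : ∑ j, f' (j + 1) 0 * star (f (j + 1) 0) = ∑ j, f' j 0 * star (f j 0) :=
    Equiv.sum_comp (Equiv.addRight (1 : Fin n)) fun j => f' j 0 * star (f j 0)
  rw [← sub_eq_zero, Complex.ofReal_sum, Complex.ofReal_sum, Finset.mul_sum,
    ← Finset.sum_sub_distrib]
  calc _ = ∑ j, (f' j (ℓ j) * star (f j (ℓ j)) - f' j 0 * star (f j 0)) :=
        Finset.sum_congr rfl fun j _ => (h j).1.integral_norm_sq_deriv_sub (hℓ j) (h j).2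
    _ = ∑ j, (f' (j + 1) 0 * star (f (j + 1) 0) - f' j 0 * star (f j 0)) :=
        Finset.sum_congr rfl fun j _ => by rw [(matching_iff.1 hm j).mul_star_eq]
    _ = 0 := by rw [Finset.sum_sub_distrib, hcyclic, sub_self]

theorem eqOn_zero_of_sum_integral_norm_sq_eq_zero {ι : Type*} [Fintype ι] {L : ι → ℝ}
    (hL : ∀ j, 0 < L j) {f : ι → ℝ → ℂ} (hf : ∀ j, ContinuousOn (f j) (Set.Icc 0 (L j)))
    (h : ∑ j, ∫ x in (0 : ℝ)..L j, ‖f j x‖ ^ 2 = 0) (j : ι) :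
    Set.EqOn (f j) 0 (Set.Icc 0 (L j)) := by
  have hnonneg (j : ι) : 0 ≤ ∫ x in (0 : ℝ)..L j, ‖f j x‖ ^ 2 :=
    intervalIntegral.integral_nonneg (hL j).le fun x _ => by positivity
  exact eqOn_zero_of_integral_norm_sq_eq_zero (hL j) (hf j)
    ((Finset.sum_eq_zero_iff_of_nonneg fun j _ => hnonneg j).1 h j (Finset.mem_univ j))

theorem eigenspace_eq_bot (hℓ : ∀ j, 0 < ℓ j) {z : ℂ}
    (hz : ∀ σ : ℝ, 0 ≤ σ → z ≠ (σ : ℂ) ^ 2) : eigenspace (graphLaplacian α ℓ) z = ⊥ := by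
  rw [Submodule.eq_bot_iff]
  intro u hu
  obtain ⟨f, f', h, hm, hf⟩ := exists_rep_of_mem_eigenspace hu
  have henergy := energy_identity (fun j => (hℓ j).le) h hm
  have hnonneg (g : Fin n → ℝ → ℂ) : 0 ≤ ∑ j, ∫ x in (0 : ℝ)..ℓ j, ‖g j x‖ ^ 2 :=
    Finset.sum_nonneg fun j _ =>
      intervalIntegral.integral_nonneg (hℓ j).le fun x _ => by positivity
  have hnorm : ∑ j, ∫ x in (0 : ℝ)..ℓ j, ‖f j x‖ ^ 2 = 0 := by
    by_contra hne
    refine hz (Real.sqrt ((∑ j, ∫ x in (0 : ℝ)..ℓ j, ‖f' j x‖ ^ 2) /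
      ∑ j, ∫ x in (0 : ℝ)..ℓ j, ‖f j x‖ ^ 2)) (Real.sqrt_nonneg _) ?_
    rw [← Complex.ofReal_pow, Real.sq_sqrt (div_nonneg (hnonneg f') (hnonneg f)),
      Complex.ofReal_div, henergy, mul_div_cancel_right₀ _ (Complex.ofReal_ne_zero.2 hne)]
  have hzero := eqOn_zero_of_sum_integral_norm_sq_eq_zero hℓ
    (fun j => (h j).1.continuousOn) hnorm
  ext j
  filter_upwards [hf j, ae_restrict_mem measurableSet_Ioo,
    Lp.coeFn_zero ℂ 2 (volume.restrict (Set.Ioo 0 (ℓ j)))] with x hux hx h0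
  rw [hux, hzero j (Set.Ioo_subset_Icc_self hx)]
  exact h0.symm

variable (α ℓ) in
/-- The initial data `(f 0, f' 0)` on the edges of the eigenfunctions to the eigenvalue `σ²`. -/
def eigenData (σ : ℝ) : Submodule ℂ (Fin n → Fin 2 → ℂ) where
  carrier := {v | Matching α ℓ (fun j => edgeSol σ (v j)) fun j => edgeSolDeriv σ (v j)}
  zero_mem' := fun j => by simp [edgeSol, edgeSolDeriv]
  add_mem' := fun {v w} hv hw j => by
    have hv := hv j
    have hw := hw j
    simp only [edgeSol, edgeSolDeriv, Pi.add_apply] at *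
    exact ⟨by linear_combination hv.1 + hw.1, by linear_combination hv.2 + hw.2⟩
  smul_mem' := fun c v hv j => by
    have hv := hv j
    simp only [edgeSol, edgeSolDeriv, Pi.smul_apply, smul_eq_mul] at *
    exact ⟨by linear_combination c * hv.1, by linear_combination c * hv.2⟩

theorem mem_eigenData_iff {σ : ℝ} {v : Fin n → Fin 2 → ℂ} :
    v ∈ eigenData α ℓ σ ↔ ∀ j, VertexMatching (α j) (edgeSol σ (v j) (ℓ j))
      (edgeSolDeriv σ (v j) (ℓ j)) (v (j + 1) 0) (v (j + 1) 1) := by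
  refine forall_congr' fun j => ?_
  rw [← edgeSol_zero_right σ (v (j + 1)), ← edgeSolDeriv_zero_right σ (v (j + 1))]
  rfl

theorem slope_eq_zero_of_mem_eigenData_zero (hℓ : ∀ j, 0 < ℓ j) {v : Fin n → Fin 2 → ℂ}
    (hv : v ∈ eigenData α ℓ 0) (j : Fin n) : v j 1 = 0 := by
  have henergy := energy_identity (fun j => (hℓ j).le)
    (fun j => ⟨isH1_edgeSol 0 (v j), isH1_edgeSolDeriv 0 (v j)⟩) hv
  rw [Complex.ofReal_zero, zero_pow two_ne_zero, zero_mul, Complex.ofReal_eq_zero] at henergy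
  have hzero := eqOn_zero_of_sum_integral_norm_sq_eq_zero hℓ
    (fun j => (continuous_edgeSolDeriv 0 (v j)).continuousOn) henergy j
    (Set.left_mem_Icc.2 (hℓ j).le)
  rwa [edgeSolDeriv_zero_right] at hzero

end

theorem memLp_edgeSol (σ : ℝ) (v : Fin 2 → ℂ) (L : ℝ) :
    MemLp (edgeSol σ v) 2 (volume.restrict (Set.Ioo 0 L)) :=
  memLp_Ioo_of_continuous (continuous_edgeSol σ v) 0 L

/-- The function on the graph with given initial data on the edges, as an element of `L²`. -/
def edgeSolL2 (ℓ : Fin n → ℝ) (σ : ℝ) : (Fin n → Fin 2 → ℂ) →ₗ[ℂ] GraphL2 ℓ where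
  toFun v := WithLp.toLp 2 fun j => (memLp_edgeSol σ (v j) (ℓ j)).toLp
  map_add' v w := by
    ext1 j
    have h := MemLp.toLp_add (memLp_edgeSol σ (v j) (ℓ j)) (memLp_edgeSol σ (w j) (ℓ j))
    refine Eq.trans (MemLp.toLp_congr (memLp_edgeSol σ (v j + w j) (ℓ j)) _ ?_) h
    exact ae_of_all _ fun x => by simp only [edgeSol, Pi.add_apply]; ring
  map_smul' c v := by
    ext1 j
    have h := MemLp.toLp_const_smul c (memLp_edgeSol σ (v j) (ℓ j))
    refine Eq.trans (MemLp.toLp_congr (memLp_edgeSol σ (c • v j) (ℓ j)) _ ?_) h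
    exact ae_of_all _ fun x => by simp only [edgeSol, Pi.smul_apply, smul_eq_mul]; ring

theorem coeFn_edgeSolL2 (ℓ : Fin n → ℝ) (σ : ℝ) (v : Fin n → Fin 2 → ℂ) (j : Fin n) :
    (edgeSolL2 ℓ σ v j : ℝ → ℂ) =ᵐ[volume.restrict (Set.Ioo 0 (ℓ j))] edgeSol σ (v j) :=
  MemLp.coeFn_toLp (memLp_edgeSol σ (v j) (ℓ j))

theorem edgeSolL2_injective {ℓ : Fin n → ℝ} (hℓ : ∀ j, 0 < ℓ j) (σ : ℝ) :
    Function.Injective (edgeSolL2 ℓ σ) := by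
  rw [← LinearMap.ker_eq_bot, LinearMap.ker_eq_bot']
  intro v hv
  refine funext fun j => eq_zero_of_edgeSol_ae_eq_zero (hℓ j) (σ := σ) ?_
  refine (coeFn_edgeSolL2 ℓ σ v j).symm.trans ?_
  rw [hv]
  exact Lp.coeFn_zero _ _ _

variable [NeZero n] {α ℓ : Fin n → ℝ}

theorem eigenspace_le_map_edgeSolL2 (hℓ : ∀ j, 0 ≤ ℓ j) (σ : ℝ) :
    eigenspace (graphLaplacian α ℓ) ((σ : ℂ) ^ 2) ≤ (eigenData α ℓ σ).map (edgeSolL2 ℓ σ) := by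
  intro u hu
  obtain ⟨f, f', h, hm, hf⟩ := exists_rep_of_mem_eigenspace hu
  have hsol (j : Fin n) := (h j).1.eqOn_edgeSol (h j).2
  refine ⟨fun j => ![f j 0, f' j 0], mem_eigenData_iff.2 fun j => ?_, ?_⟩
  · have hend := hsol j (Set.right_mem_Icc.2 (hℓ j))
    simp only [Prod.mk.injEq] at hend
    rw [← hend.1, ← hend.2]
    exact hm j
  · ext j
    filter_upwards [coeFn_edgeSolL2 ℓ σ (fun j => ![f j 0, f' j 0]) j, hf j,
      ae_restrict_mem measurableSet_Ioo] with x hv hux hx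
    rw [hv, hux, (Prod.mk.inj (hsol j (Set.Ioo_subset_Icc_self hx))).1]

theorem map_edgeSolL2_le_eigenspace (σ : ℝ) :
    (eigenData α ℓ σ).map (edgeSolL2 ℓ σ) ≤ eigenspace (graphLaplacian α ℓ) ((σ : ℂ) ^ 2) := by
  rintro _ ⟨v, hv, rfl⟩
  refine mem_eigenspace_iff.2 ⟨fun j => edgeSol σ (v j), fun j => edgeSolDeriv σ (v j),
    fun j x => -(σ ^ 2 * edgeSol σ (v j) x),
    fun j => ⟨isH1_edgeSol σ (v j), isH1_edgeSolDeriv σ (v j)⟩, hv,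
    fun j => ⟨coeFn_edgeSolL2 ℓ σ v j, ?_⟩⟩
  filter_upwards [Lp.coeFn_smul ((σ : ℂ) ^ 2) (edgeSolL2 ℓ σ v j), coeFn_edgeSolL2 ℓ σ v j]
    with x hsmul hvx
  have hz : (((σ : ℂ) ^ 2 • edgeSolL2 ℓ σ v) j : ℝ → ℂ) x =
    (σ : ℂ) ^ 2 * edgeSolL2 ℓ σ v j x := hsmul
  rw [hz, hvx, neg_neg]

theorem toENat_rank_eigenspace (hℓ : ∀ j, 0 < ℓ j) (σ : ℝ) :
    Cardinal.toENat (Module.rank ℂ (eigenspace (graphLaplacian α ℓ) ((σ : ℂ) ^ 2))) =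
      Module.finrank ℂ (eigenData α ℓ σ) := by
  have hmap : eigenspace (graphLaplacian α ℓ) ((σ : ℂ) ^ 2) =
      (eigenData α ℓ σ).map (edgeSolL2 ℓ σ) :=
    (eigenspace_le_map_edgeSolL2 (fun j => (hℓ j).le) σ).antisymm (map_edgeSolL2_le_eigenspace σ)
  rw [hmap, ← (Submodule.equivMapOfInjective _ (edgeSolL2_injective hℓ σ) _).rank_eq,
    ← Module.finrank_eq_rank, map_natCast]

end Eigenspaces

/-! ### Linear systems on a cycle -/

section Steps

variable {n : ℕ} [NeZero n]

theorem ofNat_add (a b : ℕ) : Fin.ofNat n (a + b) = Fin.ofNat n a + Fin.ofNat n b := by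
  ext; simp [Fin.val_add]

theorem step_zero_right (s : Fin n) : step s 0 = s := add_zero s

theorem step_succ (s : Fin n) (m : ℕ) : step s (m + 1) = step s m + 1 := by
  rw [step, step, ofNat_add, add_assoc]; rfl

theorem step_add_one (s : Fin n) (m : ℕ) : step (s + 1) m = step s (m + 1) := by
  rw [step_succ, step, step, add_right_comm]

theorem step_self (s : Fin n) : step s n = s := by
  rw [step, Fin.ofNat_self, add_zero]

theorem step_zero_val (j : Fin n) : step 0 (j : ℕ) = j := by
  rw [step, zero_add, Fin.ofNat_val_eq_self]

theorem step_sub_ofNat {s : Fin n} {m d : ℕ} (h : d ≤ m) :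
    step s m - Fin.ofNat n d = step s (m - d) := by
  rw [sub_eq_iff_eq_add, step, step, add_assoc, ← ofNat_add, Nat.sub_add_cancel h]

end Steps

section Transport

variable {n : ℕ} [NeZero n] {K V : Type*} [Field K] [AddCommGroup V] [Module K V]

/-- Transport of a vector from the side `j` through the `m` vertices `j, …, j + m - 1`, where `G i`
is the transfer map of the vertex `i`. -/
def transport (G : Fin n → Module.End K V) (j : Fin n) : ℕ → Module.End K V
  | 0 => 1
  | m + 1 => G (step j m) * transport G j m

theorem map_prod_reverse_ofFn {M : Type*} [Monoid M] (φ : M →* Module.End K V) (A : Fin n → M) :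
    φ (List.ofFn A).reverse.prod = transport (fun j => φ (A j)) 0 n := by
  have partialProd : ∀ k, φ (List.ofFn fun j : Fin k => A (step 0 j)).reverse.prod =
      transport (fun j => φ (A j)) 0 k := by
    intro k
    induction k with
    | zero => simp [transport]
    | succ k ih =>
      rw [List.ofFn_succ', List.concat_eq_append, List.reverse_append, List.prod_append, map_mul]
      simp [ih, transport]
  rw [← partialProd]
  simp only [step_zero_val]

/-- The solutions of the cyclic recursion `v (j + 1) = G j (v j)`. -/
def cyclicSolutions (G : Fin n → Module.End K V) : Submodule K (Fin n → V) where
  carrier := {v | ∀ j, v (j + 1) = G j (v j)}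
  zero_mem' := fun j => by simp
  add_mem' := fun hv hw j => by simp [hv j, hw j]
  smul_mem' := fun c v hv j => by simp [hv j]

variable {G : Fin n → Module.End K V}

theorem apply_step_of_mem_cyclicSolutions {v : Fin n → V} (hv : v ∈ cyclicSolutions G)
    (j : Fin n) (k : ℕ) : v (step j k) = transport G j k (v j) := by
  induction k with
  | zero => rw [step_zero_right]; rfl
  | succ k ih => rw [step_succ, hv, ih]; rfl

theorem transport_mem_cyclicSolutions {w : V} (hw : transport G 0 n w = w) :
    (fun j : Fin n => transport G 0 j w) ∈ cyclicSolutions G := by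
  intro j
  have transport_succ : transport G 0 (j + 1 : ℕ) w = G j (transport G 0 j w) := by
    rw [transport, step_zero_val, Module.End.mul_apply]
  rw [← transport_succ]
  rcases Nat.lt_or_ge (j + 1 : ℕ) n with h | h
  · exact congrArg (transport G 0 · w) (Fin.val_add_one_of_lt' h)
  · have val_succ : (j + 1 : ℕ) = n := le_antisymm j.isLt h
    have succ_eq_zero : j + 1 = 0 := by
      rw [← step_zero_val j, ← step_succ, val_succ, step_self]
    simp only [succ_eq_zero, val_succ, hw]
    rfl

theorem finrank_cyclicSolutions (G : Fin n → Module.End K V) :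
    Module.finrank K (cyclicSolutions G) =
      Module.finrank K (Module.End.eigenspace (transport G 0 n) 1) := by
  let Φ : V →ₗ[K] Fin n → V := LinearMap.pi fun j => transport G 0 j
  have hΦ : Function.Injective Φ := fun v w h => congrFun h 0
  have map_eq : (Module.End.eigenspace (transport G 0 n) 1).map Φ = cyclicSolutions G := by
    ext v
    constructor
    · rintro ⟨w, hw, rfl⟩
      rw [SetLike.mem_coe, Module.End.mem_eigenspace_iff, one_smul] at hw
      exact transport_mem_cyclicSolutions hw
    · intro hv
      refine ⟨v 0, ?_, funext fun j => ?_⟩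
      · rw [SetLike.mem_coe, Module.End.mem_eigenspace_iff,
          ← apply_step_of_mem_cyclicSolutions hv, one_smul, step_self]
      · exact (apply_step_of_mem_cyclicSolutions hv 0 j).symm.trans
          (congrArg v (step_zero_val j))
  rw [← map_eq]
  exact (Submodule.equivMapOfInjective Φ hΦ _).finrank_eq.symm

end Transport

section Components

variable {n : ℕ} [NeZero n] (α : Fin n → ℝ)

/-- The number of steps back from the side `j` to the exceptional vertex at which its exceptional
component starts. -/
def prevDist (j : Fin n) : ℕ :=
  sInf {m : ℕ | 1 ≤ m ∧ IsExceptional (α (j - Fin.ofNat n m))}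

/-- The exceptional vertex at which the exceptional component of the side `j` starts. -/
def prevExceptional (j : Fin n) : Fin n := j - Fin.ofNat n (prevDist α j)

variable {α}

theorem prevDist_spec (hex : ∃ j, IsExceptional (α j)) (j : Fin n) :
    1 ≤ prevDist α j ∧ IsExceptional (α (prevExceptional α j)) := by
  obtain ⟨e, he⟩ := hex
  have hback : j - Fin.ofNat n ((j - e : Fin n) + n) = e := by
    rw [ofNat_add, Fin.ofNat_self, Fin.ofNat_val_eq_self, add_zero, sub_sub_cancel]
  exact Nat.sInf_mem (s := {m : ℕ | 1 ≤ m ∧ IsExceptional (α (j - Fin.ofNat n m))})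
    ⟨(j - e : Fin n) + n, le_add_left (NeZero.pos n), by rwa [hback]⟩

theorem prevDist_le {j : Fin n} {m : ℕ} (hm : 1 ≤ m)
    (h : IsExceptional (α (j - Fin.ofNat n m))) : prevDist α j ≤ m :=
  Nat.sInf_le ⟨hm, h⟩

theorem step_prevExceptional (j : Fin n) : step (prevExceptional α j) (prevDist α j) = j :=
  sub_add_cancel _ _

theorem compSize_spec {s : Fin n} (hs : IsExceptional (α s)) :
    1 ≤ compSize α s ∧ IsExceptional (α (nextExceptional α s)) :=
  Nat.sInf_mem (s := {m : ℕ | 1 ≤ m ∧ IsExceptional (α (step s m))})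
    ⟨n, NeZero.pos n, by rwa [step_self]⟩

theorem compSize_le {s : Fin n} {m : ℕ} (hm : 1 ≤ m) (h : IsExceptional (α (step s m))) :
    compSize α s ≤ m :=
  Nat.sInf_le ⟨hm, h⟩

theorem prevDist_succ_of_isExceptional {j : Fin n} (hj : IsExceptional (α j)) :
    prevDist α (j + 1) = 1 := by
  have hback : j + 1 - Fin.ofNat n 1 = j := add_sub_cancel_right j 1
  exact le_antisymm (prevDist_le le_rfl (hback.symm ▸ hj)) (prevDist_spec ⟨j, hj⟩ _).1

theorem prevExceptional_succ_of_isExceptional {j : Fin n} (hj : IsExceptional (α j)) :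
    prevExceptional α (j + 1) = j := by
  rw [prevExceptional, prevDist_succ_of_isExceptional hj]
  exact add_sub_cancel_right j 1

theorem succ_sub_ofNat_succ (j : Fin n) (m : ℕ) :
    j + 1 - Fin.ofNat n (m + 1) = j - Fin.ofNat n m := by
  rw [ofNat_add]
  exact add_sub_add_right_eq_sub j _ 1

theorem prevDist_succ_of_not_isExceptional (hex : ∃ j, IsExceptional (α j)) {j : Fin n}
    (hj : ¬IsExceptional (α j)) : prevDist α (j + 1) = prevDist α j + 1 := by
  apply le_antisymm
  · exact prevDist_le (by omega) (by rw [succ_sub_ofNat_succ]; exact (prevDist_spec hex j).2)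
  · obtain ⟨hpos, hprev⟩ := prevDist_spec hex (j + 1)
    obtain ⟨m, hm⟩ := Nat.exists_eq_add_of_le' hpos
    rw [prevExceptional, hm, succ_sub_ofNat_succ] at hprev
    rw [hm]
    rcases Nat.eq_zero_or_pos m with rfl | hm_pos
    · exact absurd (by simpa using hprev) hj
    · exact Nat.succ_le_succ (prevDist_le hm_pos hprev)

theorem prevExceptional_succ_of_not_isExceptional (hex : ∃ j, IsExceptional (α j)) {j : Fin n}
    (hj : ¬IsExceptional (α j)) : prevExceptional α (j + 1) = prevExceptional α j := by
  rw [prevExceptional, prevDist_succ_of_not_isExceptional hex hj, succ_sub_ofNat_succ,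
    prevExceptional]

theorem prevDist_nextExceptional {s : Fin n} (hs : IsExceptional (α s)) :
    prevDist α (nextExceptional α s) = compSize α s := by
  obtain ⟨hsize, -⟩ := compSize_spec hs
  apply le_antisymm
  · exact prevDist_le hsize (by rwa [nextExceptional, step, add_sub_cancel_right])
  · by_contra! hlt
    obtain ⟨hpos, hprev⟩ := prevDist_spec ⟨s, hs⟩ (nextExceptional α s)
    have hstep : prevExceptional α (nextExceptional α s) =
        step s (compSize α s - prevDist α (nextExceptional α s)) := step_sub_ofNat hlt.le
    have := compSize_le (by omega) (hstep ▸ hprev)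
    omega

theorem prevExceptional_nextExceptional {s : Fin n} (hs : IsExceptional (α s)) :
    prevExceptional α (nextExceptional α s) = s := by
  rw [prevExceptional, prevDist_nextExceptional hs, nextExceptional, step, add_sub_cancel_right]

theorem nextExceptional_prevExceptional {j : Fin n} (hj : IsExceptional (α j)) :
    nextExceptional α (prevExceptional α j) = j := by
  have hinj : Set.InjOn (nextExceptional α) {s | IsExceptional (α s)} :=
    (Set.LeftInvOn.injOn (f₁' := prevExceptional α))
      fun _ hs => prevExceptional_nextExceptional hs
  have hmaps : Set.MapsTo (nextExceptional α) {s | IsExceptional (α s)}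
      {s | IsExceptional (α s)} := fun _ hs => (compSize_spec hs).2
  obtain ⟨s, hs, rfl⟩ := ((Set.toFinite _).injOn_iff_bijOn_of_mapsTo hmaps).1 hinj |>.surjOn hj
  rw [prevExceptional_nextExceptional hs]

theorem exceptional_induction (hex : ∃ j, IsExceptional (α j)) {p : Fin n → Prop}
    (exceptional : ∀ j, IsExceptional (α j) → p (j + 1))
    (regular : ∀ j, ¬IsExceptional (α j) → p j → p (j + 1)) (j : Fin n) : p j := by
  induction hd : prevDist α j generalizing j with
  | zero => exact absurd (prevDist_spec hex j).1 (by omega)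
  | succ m ih =>
    obtain ⟨i, rfl⟩ : ∃ i, j = i + 1 := ⟨j - 1, (sub_add_cancel j 1).symm⟩
    by_cases hi : IsExceptional (α i)
    · exact exceptional i hi
    · rw [prevDist_succ_of_not_isExceptional hex hi] at hd
      exact regular i hi (ih i (by omega))

end Components

section Boundary

variable {n : ℕ} [NeZero n] {K V : Type*} [Field K] [AddCommGroup V] [Module K V]
  (α : Fin n → ℝ) (G : Fin n → Module.End K V) (x : Fin n → V) (e : Fin n → V →ₗ[K] K)

/-- The solutions of `v (j + 1) = G j (v j)` at the non-exceptional vertices, with the boundary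
conditions `v (j + 1) ∈ K ∙ x j` and `e j (v j) = 0` at the exceptional ones. -/
def boundarySolutions : Submodule K (Fin n → V) where
  carrier := {v | ∀ j, (¬IsExceptional (α j) → v (j + 1) = G j (v j)) ∧
    (IsExceptional (α j) → v (j + 1) ∈ K ∙ x j ∧ e j (v j) = 0)}
  zero_mem' := fun j => by simp
  add_mem' := fun hv hw j => ⟨fun h => by simp [(hv j).1 h, (hw j).1 h], fun h =>
    ⟨add_mem ((hv j).2 h).1 ((hw j).2 h).1, by simp [((hv j).2 h).2, ((hw j).2 h).2]⟩⟩
  smul_mem' := fun c v hv j => ⟨fun h => by simp [(hv j).1 h], fun h =>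
    ⟨Submodule.smul_mem _ c ((hv j).2 h).1, by simp [((hv j).2 h).2]⟩⟩

/-- The exceptional vertices `s` such that `x s ≠ 0` is transported to a vector that satisfies the
boundary condition at the end of the exceptional component starting at `s`. -/
def solvableStarts : Set (Fin n) :=
  {s | IsExceptional (α s) ∧ x s ≠ 0 ∧
    e (nextExceptional α s) (transport G (s + 1) (compSize α s - 1) (x s)) = 0}

/-- The solution of the recursion that starts with `c s • x s` behind each exceptional vertex `s`;
the boundary conditions at the ends of the components are disregarded. -/
def forwardSolution : (Fin n → K) →ₗ[K] (Fin n → V) :=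
  LinearMap.pi fun j => (LinearMap.proj (prevExceptional α j)).smulRight
    (transport G (prevExceptional α j + 1) (prevDist α j - 1) (x (prevExceptional α j)))

variable {α x}

theorem forwardSolution_succ_of_isExceptional {j : Fin n} (hj : IsExceptional (α j))
    (c : Fin n → K) : forwardSolution α G x c (j + 1) = c j • x j := by
  simp [forwardSolution, prevExceptional_succ_of_isExceptional hj,
    prevDist_succ_of_isExceptional hj, transport]

theorem forwardSolution_succ_of_not_isExceptional (hex : ∃ j, IsExceptional (α j)) {j : Fin n}
    (hj : ¬IsExceptional (α j)) (c : Fin n → K) :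
    forwardSolution α G x c (j + 1) = G j (forwardSolution α G x c j) := by
  obtain ⟨m, hm⟩ := Nat.exists_eq_add_of_le' (prevDist_spec hex j).1
  have hstep : step (prevExceptional α j + 1) m = j := by
    rw [step_add_one, ← hm, step_prevExceptional]
  simp [forwardSolution, prevExceptional_succ_of_not_isExceptional hex hj,
    prevDist_succ_of_not_isExceptional hex hj, hm, transport, hstep]

theorem forwardSolution_nextExceptional {s : Fin n} (hs : IsExceptional (α s)) (c : Fin n → K) :
    forwardSolution α G x c (nextExceptional α s) =
      c s • transport G (s + 1) (compSize α s - 1) (x s) := by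
  simp [forwardSolution, prevExceptional_nextExceptional hs, prevDist_nextExceptional hs]

variable {G e}

theorem forwardSolution_mem_boundarySolutions (hex : ∃ j, IsExceptional (α j)) {c : Fin n → K}
    (hc : ∀ s ∉ solvableStarts α G x e, c s = 0) :
    forwardSolution α G x c ∈ boundarySolutions α G x e := by
  refine fun j =>
    ⟨fun hj => forwardSolution_succ_of_not_isExceptional G hex hj c, fun hj => ⟨?_, ?_⟩⟩
  · rw [forwardSolution_succ_of_isExceptional G hj]
    exact Submodule.smul_mem _ _ (Submodule.mem_span_singleton_self _)
  · obtain ⟨s, hs, rfl⟩ : ∃ s, IsExceptional (α s) ∧ nextExceptional α s = j :=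
      ⟨_, (prevDist_spec hex j).2, nextExceptional_prevExceptional hj⟩
    rw [forwardSolution_nextExceptional G hs, map_smul]
    by_cases hmem : s ∈ solvableStarts α G x e
    · rw [hmem.2.2, smul_zero]
    · rw [hc s hmem, zero_smul]

theorem exists_forwardSolution_eq (hex : ∃ j, IsExceptional (α j)) {v : Fin n → V}
    (hv : v ∈ boundarySolutions α G x e) : ∃ c : Fin n → K,
      (∀ s ∉ solvableStarts α G x e, c s = 0) ∧ forwardSolution α G x c = v := by
  have exists_coeff : ∀ s, ∃ a : K, (IsExceptional (α s) → v (s + 1) = a • x s) ∧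
      (¬IsExceptional (α s) ∨ x s = 0 → a = 0) := by
    intro s
    by_cases hs : IsExceptional (α s)
    · obtain ⟨a, ha⟩ := Submodule.mem_span_singleton.1 ((hv s).2 hs).1
      by_cases hx : x s = 0
      · exact ⟨0, fun _ => by rw [← ha, hx, smul_zero, smul_zero], fun _ => rfl⟩
      · exact ⟨a, fun _ => ha.symm, fun h => by tauto⟩
    · exact ⟨0, fun h => absurd h hs, fun _ => rfl⟩
  choose c hcv hc0 using exists_coeff
  have forward_eq : forwardSolution α G x c = v := funext <| exceptional_induction hex
    (fun j hj => (forwardSolution_succ_of_isExceptional G hj c).trans (hcv j hj).symm)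
    (fun j hj ih => by rw [forwardSolution_succ_of_not_isExceptional G hex hj, ih, (hv j).1 hj])
  refine ⟨c, fun s hs => ?_, forward_eq⟩
  by_cases hreg : ¬IsExceptional (α s) ∨ x s = 0
  · exact hc0 s hreg
  · push Not at hreg
    have hend := ((hv _).2 (compSize_spec hreg.1).2).2
    rw [← forward_eq, forwardSolution_nextExceptional G hreg.1, map_smul, smul_eq_mul] at hend
    exact (mul_eq_zero.1 hend).resolve_right fun h => hs ⟨hreg.1, hreg.2, h⟩

theorem eq_zero_of_forwardSolution_eq_zero {c : Fin n → K} {s : Fin n}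
    (hc : forwardSolution α G x c = 0) (hs : s ∈ solvableStarts α G x e) : c s = 0 := by
  have h := congrFun hc (s + 1)
  rw [forwardSolution_succ_of_isExceptional G hs.1] at h
  exact (smul_eq_zero.1 h).resolve_right hs.2.1

theorem finrank_boundarySolutions (hex : ∃ j, IsExceptional (α j)) :
    Module.finrank K (boundarySolutions α G x e) = (solvableStarts α G x e).ncard := by
  classical
  set S := solvableStarts α G x e
  let Ψ := forwardSolution α G x ∘ₗ Function.ExtendByZero.linearMap K (Subtype.val : S → Fin n)
  have extend_apply : ∀ (c : S → K) (s : S),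
      Function.ExtendByZero.linearMap K (Subtype.val : S → Fin n) c s = c s := fun c s =>
    Subtype.val_injective.extend_apply _ _ _
  have extend_not_mem : ∀ (c : S → K), ∀ s ∉ S,
      Function.ExtendByZero.linearMap K (Subtype.val : S → Fin n) c s = 0 := fun c s hs =>
    Function.extend_apply' _ _ _ fun ⟨t, ht⟩ => hs (ht ▸ t.2)
  have injective : Function.Injective Ψ := by
    refine (injective_iff_map_eq_zero Ψ).2 fun c hc => funext fun s => ?_
    refine (extend_apply c s).symm.trans ?_
    exact eq_zero_of_forwardSolution_eq_zero hc s.2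
  have range_eq : LinearMap.range Ψ = boundarySolutions α G x e := by
    ext v
    constructor
    · rintro ⟨c, rfl⟩
      exact forwardSolution_mem_boundarySolutions hex (extend_not_mem c)
    · intro hv
      obtain ⟨c, hc, rfl⟩ := exists_forwardSolution_eq hex hv
      refine ⟨fun s => c s, congrArg (forwardSolution α G x) (funext fun s => ?_)⟩
      by_cases hs : s ∈ S
      · exact extend_apply _ ⟨s, hs⟩
      · rw [extend_not_mem _ s hs, hc s hs]
  rw [← range_eq, LinearMap.finrank_range_of_inj injective, Module.finrank_fintype_fun_eq_card,
    ← Nat.card_eq_fintype_card, Nat.card_coe_set_eq]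

end Boundary

/-! ### Angles and transfer matrices -/

section Angles

variable {a : ℝ}

theorem angleMu_eq_two_mul (a : ℝ) : angleMu a = 2 * matchingAngle a := by
  rw [angleMu, matchingAngle]; ring

theorem isExceptional_iff_sin_eq_zero (ha : 0 < a) :
    IsExceptional a ↔ Real.sin (angleMu a) = 0 := by
  have hpi := Real.pi_pos
  rw [Real.sin_eq_zero_iff, IsExceptional, angleMu]
  constructor
  · rintro ⟨k, hk, rfl⟩
    have hk0 : (k : ℝ) ≠ 0 := by positivity
    exact ⟨k, by push_cast; field_simp⟩
  · rintro ⟨m, hm⟩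
    have hmpi : 0 < (m : ℝ) * Real.pi := by rw [hm]; positivity
    have hm_pos : 0 < m := by exact_mod_cast pos_of_mul_pos_left hmpi hpi.le
    lift m to ℕ using hm_pos.le
    have hm0 : (m : ℝ) ≠ 0 := by exact_mod_cast hm_pos.ne'
    refine ⟨m, by omega, ?_⟩
    push_cast at hm
    field_simp at hm ⊢
    linarith

theorem sin_matchingAngle_ne_zero (ha : 0 < a) (h : ¬IsExceptional a) :
    Real.sin (matchingAngle a) ≠ 0 := by
  rw [isExceptional_iff_sin_eq_zero ha, angleMu_eq_two_mul, Real.sin_two_mul] at h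
  exact fun h0 => h (by rw [h0]; ring)

theorem cos_matchingAngle_ne_zero (ha : 0 < a) (h : ¬IsExceptional a) :
    Real.cos (matchingAngle a) ≠ 0 := by
  rw [isExceptional_iff_sin_eq_zero ha, angleMu_eq_two_mul, Real.sin_two_mul] at h
  exact fun h0 => h (by rw [h0]; ring)

theorem parity_eq_one_iff : parity a = 1 ↔ Real.sin (matchingAngle a) = 0 := by
  rw [parity, angleMu_eq_two_mul, Real.cos_two_mul, Real.cos_sq', ← sq_eq_zero_iff]
  constructor <;> intro h <;> linarith

theorem parity_eq_neg_one_iff : parity a = -1 ↔ Real.cos (matchingAngle a) = 0 := by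
  rw [parity, angleMu_eq_two_mul, Real.cos_two_mul, ← sq_eq_zero_iff]
  constructor <;> intro h <;> linarith

theorem parity_eq_one_or_neg_one (ha : 0 < a) (h : IsExceptional a) :
    parity a = 1 ∨ parity a = -1 := by
  rwa [isExceptional_iff_sin_eq_zero ha, Real.sin_eq_zero_iff_cos_eq] at h

/-- The factor by which the values of a function in the domain of the quantum graph Laplacian are
multiplied at a vertex of non-exceptional angle `a`; the derivatives are divided by it. -/
def jump (a : ℝ) : ℝ := Real.cot (matchingAngle a)

theorem jump_ne_zero (ha : 0 < a) (h : ¬IsExceptional a) : jump a ≠ 0 := by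
  rw [jump, Real.cot_eq_cos_div_sin]
  exact div_ne_zero (cos_matchingAngle_ne_zero ha h) (sin_matchingAngle_ne_zero ha h)

variable {f₁ f₁' f₂ f₂' : ℂ}

theorem vertexMatching_iff_of_not_isExceptional (ha : 0 < a) (h : ¬IsExceptional a) :
    VertexMatching a f₁ f₁' f₂ f₂' ↔ f₂ = jump a * f₁ ∧ f₂' = (jump a : ℂ)⁻¹ * f₁' := by
  have hs : (Real.sin (matchingAngle a) : ℂ) ≠ 0 := mod_cast sin_matchingAngle_ne_zero ha h
  have hc : (Real.cos (matchingAngle a) : ℂ) ≠ 0 := mod_cast cos_matchingAngle_ne_zero ha h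
  rw [VertexMatching, jump, Real.cot_eq_cos_div_sin, Complex.ofReal_div, inv_div,
    div_mul_eq_mul_div, div_mul_eq_mul_div, eq_div_iff hs, eq_div_iff hc, mul_comm f₂,
    mul_comm f₂']

theorem vertexMatching_iff_of_parity_eq_one (h : parity a = 1) :
    VertexMatching a f₁ f₁' f₂ f₂' ↔ f₁ = 0 ∧ f₂' = 0 := by
  have hc : Real.cos (matchingAngle a) ≠ 0 := fun h0 => by
    linarith [parity_eq_neg_one_iff.2 h0]
  simp [-Complex.ofReal_cos, -Complex.ofReal_sin, VertexMatching, parity_eq_one_iff.1 h, hc]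

theorem vertexMatching_iff_of_parity_eq_neg_one (h : parity a = -1) :
    VertexMatching a f₁ f₁' f₂ f₂' ↔ f₂ = 0 ∧ f₁' = 0 := by
  have hs : Real.sin (matchingAngle a) ≠ 0 := fun h0 => by linarith [parity_eq_one_iff.2 h0]
  simp [-Complex.ofReal_cos, -Complex.ofReal_sin, VertexMatching, parity_eq_neg_one_iff.1 h, hs]

theorem vertexMatching_mul_slope_iff {c : ℂ} (hc : c ≠ 0) :
    VertexMatching a f₁ (c * f₁') f₂ (c * f₂') ↔ VertexMatching a f₁ f₁' f₂ f₂' := by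
  rw [VertexMatching, mul_left_comm _ c, mul_left_comm _ c f₁', mul_right_inj' hc]
  rfl

end Angles

section Waves

/-- The value of the wave with amplitude vector `v`. The components of `v` are the amplitudes of
`e^{iσx}` and `e^{-iσx}`, the latter up to the factor `-i`. -/
def waveValue : (Fin 2 → ℂ) →ₗ[ℂ] ℂ := LinearMap.proj 0 - Complex.I • LinearMap.proj 1

/-- The derivative, divided by `iσ`, of the wave with amplitude vector `v`. -/
def waveSlope : (Fin 2 → ℂ) →ₗ[ℂ] ℂ := LinearMap.proj 0 + Complex.I • LinearMap.proj 1

theorem waveValue_apply (v : Fin 2 → ℂ) : waveValue v = v 0 - Complex.I * v 1 := rfl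

theorem waveSlope_apply (v : Fin 2 → ℂ) : waveSlope v = v 0 + Complex.I * v 1 := rfl

theorem wave_ext {v w : Fin 2 → ℂ} (hvalue : waveValue v = waveValue w)
    (hslope : waveSlope v = waveSlope w) : v = w := by
  rw [waveValue_apply, waveValue_apply] at hvalue
  rw [waveSlope_apply, waveSlope_apply] at hslope
  ext i
  fin_cases i
  · change v 0 = w 0
    linear_combination (hvalue + hslope) / 2
  · change v 1 = w 1
    linear_combination Complex.I / 2 * (hvalue - hslope) + (v 1 - w 1) * Complex.I_sq

theorem jump_eq (a : ℝ) :
    jump a = 1 / Real.sin (angleMu a) + Real.cos (angleMu a) / Real.sin (angleMu a) := by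
  rw [jump, Real.cot_eq_cos_div_sin, angleMu_eq_two_mul, ← add_div, Real.sin_two_mul,
    Real.cos_two_mul]
  by_cases hc : Real.cos (matchingAngle a) = 0
  · simp [hc]
  · rw [← mul_div_mul_left _ _ (mul_ne_zero two_ne_zero hc)]
    ring_nf

theorem inv_jump_eq (a : ℝ) :
    (jump a)⁻¹ = 1 / Real.sin (angleMu a) - Real.cos (angleMu a) / Real.sin (angleMu a) := by
  rw [jump, Real.cot_eq_cos_div_sin, inv_div, angleMu_eq_two_mul, ← sub_div, Real.sin_two_mul,
    Real.cos_two_mul, Real.cos_sq']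
  by_cases hs : Real.sin (matchingAngle a) = 0
  · simp [hs]
  · rw [← mul_div_mul_left _ _ (mul_ne_zero two_ne_zero hs)]
    ring_nf

theorem vertexMatrix_mulVec (a : ℝ) (v : Fin 2 → ℂ) : vertexMatrix a *ᵥ v =
    ![((1 / Real.sin (angleMu a) : ℝ) : ℂ) * v 0 -
        Complex.I * ((Real.cos (angleMu a) / Real.sin (angleMu a) : ℝ) : ℂ) * v 1,
      Complex.I * ((Real.cos (angleMu a) / Real.sin (angleMu a) : ℝ) : ℂ) * v 0 +
        ((1 / Real.sin (angleMu a) : ℝ) : ℂ) * v 1] := by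
  ext i
  fin_cases i <;> simp [vertexMatrix, mulVec, dotProduct, Fin.sum_univ_two, sub_eq_add_neg]

theorem waveValue_vertexMatrix (a : ℝ) (v : Fin 2 → ℂ) :
    waveValue (vertexMatrix a *ᵥ v) = jump a * waveValue v := by
  rw [jump_eq, vertexMatrix_mulVec, waveValue_apply, waveValue_apply, Complex.ofReal_add]
  simp only [cons_val_zero, cons_val_one]
  linear_combination (-(((Real.cos (angleMu a) / Real.sin (angleMu a) : ℝ) : ℂ)) * v 0) *
    Complex.I_sq

theorem waveSlope_vertexMatrix (a : ℝ) (v : Fin 2 → ℂ) :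
    waveSlope (vertexMatrix a *ᵥ v) = (jump a : ℂ)⁻¹ * waveSlope v := by
  rw [← Complex.ofReal_inv, inv_jump_eq, vertexMatrix_mulVec, waveSlope_apply, waveSlope_apply,
    Complex.ofReal_sub]
  simp only [cons_val_zero, cons_val_one]
  linear_combination (((Real.cos (angleMu a) / Real.sin (angleMu a) : ℝ) : ℂ) * v 0) *
    Complex.I_sq

theorem vertexMatching_wave_iff {a : ℝ} (ha : 0 < a) (h : ¬IsExceptional a) {v w : Fin 2 → ℂ} :
    VertexMatching a (waveValue v) (waveSlope v) (waveValue w) (waveSlope w) ↔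
      w = vertexMatrix a *ᵥ v := by
  rw [vertexMatching_iff_of_not_isExceptional ha h, ← waveValue_vertexMatrix,
    ← waveSlope_vertexMatrix]
  exact ⟨fun hw => wave_ext hw.1 hw.2, fun hw => by rw [hw]; exact ⟨rfl, rfl⟩⟩

theorem exp_I_mul_mul (l σ : ℝ) : Complex.exp (Complex.I * l * σ) =
    Real.cos (σ * l) + Real.sin (σ * l) * Complex.I := by
  rw [Complex.ofReal_cos, Complex.ofReal_sin, ← Complex.exp_mul_I]
  congr 1
  push_cast
  ring

theorem exp_neg_I_mul_mul (l σ : ℝ) : Complex.exp (-(Complex.I * l * σ)) =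
    Real.cos (σ * l) - Real.sin (σ * l) * Complex.I := by
  have h := exp_I_mul_mul l (-σ)
  rw [neg_mul, Real.cos_neg, Real.sin_neg, Complex.ofReal_neg, Complex.ofReal_neg, neg_mul,
    mul_neg] at h
  rw [h, sub_eq_add_neg]

theorem sideMatrix_mulVec (l σ : ℝ) (v : Fin 2 → ℂ) : sideMatrix l σ *ᵥ v =
    ![Complex.exp (Complex.I * l * σ) * v 0, Complex.exp (-(Complex.I * l * σ)) * v 1] := by
  ext i
  fin_cases i <;> simp [sideMatrix, mulVec, dotProduct, Fin.sum_univ_two]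

theorem waveValue_sideMatrix (l σ : ℝ) (v : Fin 2 → ℂ) : waveValue (sideMatrix l σ *ᵥ v) =
    Real.cos (σ * l) * waveValue v + Complex.I * Real.sin (σ * l) * waveSlope v := by
  rw [sideMatrix_mulVec, exp_I_mul_mul, exp_neg_I_mul_mul, waveValue_apply, waveValue_apply,
    waveSlope_apply]
  simp only [cons_val_zero, cons_val_one]
  ring

theorem waveSlope_sideMatrix (l σ : ℝ) (v : Fin 2 → ℂ) : waveSlope (sideMatrix l σ *ᵥ v) =
    Real.cos (σ * l) * waveSlope v + Complex.I * Real.sin (σ * l) * waveValue v := by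
  rw [sideMatrix_mulVec, exp_I_mul_mul, exp_neg_I_mul_mul, waveSlope_apply, waveValue_apply,
    waveSlope_apply]
  simp only [cons_val_zero, cons_val_one]
  ring

variable {σ : ℝ}

/-- The amplitude vector of the wave `edgeSol σ p` with initial data `p`. -/
def amplitude (hσ : σ ≠ 0) : (Fin 2 → ℂ) ≃ₗ[ℂ] (Fin 2 → ℂ) where
  toFun p := ![(p 0 + p 1 / (Complex.I * σ)) / 2, Complex.I * (p 0 - p 1 / (Complex.I * σ)) / 2]
  invFun v := ![waveValue v, Complex.I * σ * waveSlope v]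
  map_add' p q := by ext i; fin_cases i <;> simp <;> ring
  map_smul' c p := by ext i; fin_cases i <;> simp <;> ring
  left_inv p := by
    have hIσ : Complex.I * σ ≠ 0 := mul_ne_zero Complex.I_ne_zero (mod_cast hσ)
    ext i
    fin_cases i
    · simp only [Fin.zero_eta, cons_val_zero, waveValue_apply, cons_val_one]
      linear_combination (-(p 0 - p 1 / (Complex.I * σ)) / 2) * Complex.I_sq
    · simp only [Fin.mk_one, cons_val_zero, waveSlope_apply, cons_val_one]
      linear_combination (p 0 - p 1 / (Complex.I * σ)) / 2 * (Complex.I * σ) * Complex.I_sq +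
        mul_div_cancel₀ (p 1) hIσ
  right_inv v := by
    have hIσ : Complex.I * σ ≠ 0 := mul_ne_zero Complex.I_ne_zero (mod_cast hσ)
    ext i
    fin_cases i
    · simp [mul_div_cancel_left₀ _ hIσ, waveValue_apply, waveSlope_apply]
    · simp only [Fin.mk_one, cons_val_zero, cons_val_one, mul_div_cancel_left₀ _ hIσ,
        waveValue_apply, waveSlope_apply]
      linear_combination (-v 1) * Complex.I_sq

theorem waveValue_amplitude (hσ : σ ≠ 0) (p : Fin 2 → ℂ) : waveValue (amplitude hσ p) = p 0 :=
  congrFun ((amplitude hσ).left_inv p) 0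

theorem I_mul_waveSlope_amplitude (hσ : σ ≠ 0) (p : Fin 2 → ℂ) :
    Complex.I * σ * waveSlope (amplitude hσ p) = p 1 :=
  congrFun ((amplitude hσ).left_inv p) 1

theorem waveValue_sideMatrix_amplitude (hσ : σ ≠ 0) (l : ℝ) (p : Fin 2 → ℂ) :
    waveValue (sideMatrix l σ *ᵥ amplitude hσ p) = edgeSol σ p l := by
  rw [waveValue_sideMatrix, edgeSol, ← mul_sinOver, ← I_mul_waveSlope_amplitude hσ p,
    waveValue_amplitude, Complex.ofReal_mul]
  ring

theorem I_mul_waveSlope_sideMatrix_amplitude (hσ : σ ≠ 0) (l : ℝ) (p : Fin 2 → ℂ) :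
    Complex.I * σ * waveSlope (sideMatrix l σ *ᵥ amplitude hσ p) = edgeSolDeriv σ p l := by
  rw [waveSlope_sideMatrix, edgeSolDeriv, ← mul_sinOver, ← I_mul_waveSlope_amplitude hσ p,
    waveValue_amplitude, Complex.ofReal_mul]
  linear_combination (σ ^ 2 * sinOver σ l * p 0) * Complex.I_sq

end Waves

section PhaseVectors

/-- The amplitude vector of the real wave `2 cos (σx + θ)`. -/
def phaseVec (θ : ℝ) : Fin 2 → ℂ :=
  ![Complex.exp (θ * Complex.I), Complex.I * Complex.exp (-(θ * Complex.I))]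

theorem waveValue_phaseVec (θ : ℝ) : waveValue (phaseVec θ) = 2 * (Real.cos θ : ℂ) := by
  rw [waveValue_apply, phaseVec, Complex.ofReal_cos, Complex.cos]
  simp only [cons_val_zero, cons_val_one, neg_mul]
  linear_combination (-Complex.exp (-(θ * Complex.I))) * Complex.I_sq

theorem waveSlope_phaseVec (θ : ℝ) :
    waveSlope (phaseVec θ) = 2 * Complex.I * (Real.sin θ : ℂ) := by
  rw [waveSlope_apply, phaseVec, Complex.ofReal_sin, Complex.sin]
  simp only [cons_val_zero, cons_val_one, neg_mul]
  linear_combination (Complex.exp (θ * Complex.I)) * Complex.I_sq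

theorem phaseVec_ne_zero (θ : ℝ) : phaseVec θ ≠ 0 := fun h =>
  Complex.exp_ne_zero (θ * Complex.I) (congrFun h 0)

/-- The common scalar factor of `xEven` and `xOdd`. -/
def xScalar : ℂ := 1 / (Real.sqrt 2 : ℂ) * Complex.exp (-(Complex.I * Real.pi / 4))

theorem xScalar_ne_zero : xScalar ≠ 0 := by
  refine mul_ne_zero (one_div_ne_zero ?_) (Complex.exp_ne_zero _)
  exact_mod_cast (Real.sqrt_pos.2 two_pos).ne'

theorem exp_pi_div_four : Complex.exp (Complex.I * Real.pi / 4) =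
    Complex.I * Complex.exp (-(Complex.I * Real.pi / 4)) := by
  nth_rw 2 [← Complex.exp_pi_div_two_mul_I]
  rw [← Complex.exp_add]
  congr 1
  ring

theorem xEven_eq : xEven = xScalar • phaseVec 0 := by
  rw [xEven, xScalar, exp_pi_div_four, mul_smul]
  simp [phaseVec, mul_comm]

theorem xOdd_eq : xOdd = xScalar • phaseVec (Real.pi / 2) := by
  have hphase : phaseVec (Real.pi / 2) = ![Complex.I, 1] := by simp [phaseVec, Complex.exp_neg]
  rw [xOdd, xScalar, exp_pi_div_four, mul_smul, hphase]
  simp [mul_comm]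

/-- The phase of `xVec a`. -/
def basePhase (a : ℝ) : ℝ := open Classical in if parity a = 1 then 0 else Real.pi / 2

theorem xVec_eq (a : ℝ) : xVec a = xScalar • phaseVec (basePhase a) := by
  rw [xVec, basePhase]
  split_ifs
  · exact xEven_eq
  · exact xOdd_eq

theorem xVec_ne_zero (a : ℝ) : xVec a ≠ 0 := by
  rw [xVec_eq]
  exact smul_ne_zero xScalar_ne_zero (phaseVec_ne_zero _)

theorem mem_span_xEven {v : Fin 2 → ℂ} : v ∈ ℂ ∙ xEven ↔ waveSlope v = 0 := by
  have hx := xScalar_ne_zero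
  rw [Submodule.mem_span_singleton, xEven_eq]
  constructor
  · rintro ⟨c, rfl⟩
    simp [waveSlope_phaseVec]
  · intro h
    refine ⟨waveValue v / (2 * xScalar), wave_ext ?_ ?_⟩
    · simp only [map_smul, waveValue_phaseVec, Real.cos_zero, smul_eq_mul, Complex.ofReal_one]
      field_simp
    · simp [waveSlope_phaseVec, h]

theorem mem_span_xOdd {v : Fin 2 → ℂ} : v ∈ ℂ ∙ xOdd ↔ waveValue v = 0 := by
  have hx := xScalar_ne_zero
  rw [Submodule.mem_span_singleton, xOdd_eq]
  constructor
  · rintro ⟨c, rfl⟩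
    simp [-Complex.ofReal_cos, waveValue_phaseVec]
  · intro h
    refine ⟨waveSlope v / (2 * Complex.I * xScalar), wave_ext ?_ ?_⟩
    · simp [-Complex.ofReal_cos, waveValue_phaseVec, h]
    · simp only [map_smul, waveSlope_phaseVec, Real.sin_pi_div_two, smul_eq_mul,
        Complex.ofReal_one]
      field_simp [Complex.I_ne_zero]

theorem dotProduct_star_xEven_eq_zero_iff {v : Fin 2 → ℂ} :
    v ⬝ᵥ star xEven = 0 ↔ waveValue v = 0 := by
  have h : v ⬝ᵥ star xEven = star xScalar * waveValue v := by
    simp only [dotProduct, xEven_eq, phaseVec, Complex.ofReal_zero, zero_mul, Complex.exp_zero,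
      neg_zero, mul_one, smul_cons, smul_eq_mul, smul_empty, Pi.star_apply, RCLike.star_def,
      Fin.sum_univ_two, cons_val_zero, cons_val_one, cons_val_fin_one, map_mul, Complex.conj_I,
      mul_neg, waveValue_apply]
    ring
  rw [h, mul_eq_zero, or_iff_right (star_ne_zero.2 xScalar_ne_zero)]

theorem dotProduct_star_xOdd_eq_zero_iff {v : Fin 2 → ℂ} :
    v ⬝ᵥ star xOdd = 0 ↔ waveSlope v = 0 := by
  have h : v ⬝ᵥ star xOdd = star xScalar * (-Complex.I) * waveSlope v := by
    simp only [dotProduct, xOdd_eq, phaseVec, Complex.ofReal_div, Complex.ofReal_ofNat,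
      Complex.exp_pi_div_two_mul_I, Complex.exp_neg, Complex.inv_I, mul_neg, Complex.I_mul_I,
      neg_neg, smul_cons, smul_eq_mul, mul_one, smul_empty, Pi.star_apply, RCLike.star_def,
      Fin.sum_univ_two, cons_val_zero, map_mul, Complex.conj_I, cons_val_one, cons_val_fin_one,
      waveSlope_apply, neg_mul]
    linear_combination (v 1 * (starRingEnd ℂ) xScalar) * Complex.I_sq
  rw [h, mul_eq_zero, or_iff_right]
  exact mul_ne_zero (star_ne_zero.2 xScalar_ne_zero) (neg_ne_zero.2 Complex.I_ne_zero)

theorem vertexMatching_wave_iff_of_isExceptional {a : ℝ} (ha : 0 < a) (h : IsExceptional a)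
    {v w : Fin 2 → ℂ} :
    VertexMatching a (waveValue v) (waveSlope v) (waveValue w) (waveSlope w) ↔
      w ∈ ℂ ∙ xVec a ∧ v ⬝ᵥ star (xVec a) = 0 := by
  rcases parity_eq_one_or_neg_one ha h with even | odd
  · rw [vertexMatching_iff_of_parity_eq_one even, xVec, if_pos even, mem_span_xEven,
      dotProduct_star_xEven_eq_zero_iff, and_comm]
  · rw [vertexMatching_iff_of_parity_eq_neg_one odd, xVec, if_neg (by rw [odd]; norm_num),
      mem_span_xOdd, dotProduct_star_xOdd_eq_zero_iff]

end PhaseVectors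

/-! ### Multiplicities -/

section Transfer

variable {n : ℕ} {α ℓ : Fin n → ℝ} {σ : ℝ}

/-- The transfer map along the side `j` and through the vertex `j`. -/
def transfer (α ℓ : Fin n → ℝ) (σ : ℝ) (j : Fin n) : Module.End ℂ (Fin 2 → ℂ) :=
  toLin' (vertexMatrix (α j) * sideMatrix (ℓ j) σ)

theorem transfer_apply (α ℓ : Fin n → ℝ) (σ : ℝ) (j : Fin n) (v : Fin 2 → ℂ) :
    transfer α ℓ σ j v = vertexMatrix (α j) *ᵥ (sideMatrix (ℓ j) σ *ᵥ v) := by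
  rw [transfer, toLin'_apply, mulVec_mulVec]

/-- The functional whose vanishing is the boundary condition at the end `j` of an exceptional
component, for amplitude vectors at the beginning of the side `j`. -/
def endFunctional (α ℓ : Fin n → ℝ) (σ : ℝ) (j : Fin n) : (Fin 2 → ℂ) →ₗ[ℂ] ℂ where
  toFun v := (sideMatrix (ℓ j) σ *ᵥ v) ⬝ᵥ star (xVec (α j))
  map_add' v w := by rw [mulVec_add, add_dotProduct]
  map_smul' c v := by rw [mulVec_smul, smul_dotProduct]; rfl

variable [NeZero n]

theorem toLin'_polygonMatrix (α ℓ : Fin n → ℝ) (σ : ℝ) :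
    toLin' (polygonMatrix α ℓ σ) = transport (transfer α ℓ σ) 0 n :=
  map_prod_reverse_ofFn ((toLinAlgEquiv' : Matrix (Fin 2) (Fin 2) ℂ ≃ₐ[ℂ] _) :
    Matrix (Fin 2) (Fin 2) ℂ →* Module.End ℂ (Fin 2 → ℂ)) _

theorem pathMatrix_mulVec (α ℓ : Fin n → ℝ) (σ : ℝ) (s : Fin n) (m : ℕ) (v : Fin 2 → ℂ) :
    pathMatrix α ℓ σ s m *ᵥ v =
      sideMatrix (ℓ (step s (m + 1))) σ *ᵥ transport (transfer α ℓ σ) (s + 1) m v := by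
  induction m with
  | zero => rfl
  | succ m ih =>
    rw [pathMatrix, ← mulVec_mulVec, ih, ← mulVec_mulVec, transport, Module.End.mul_apply,
      transfer_apply, step_add_one]

theorem solvesComponent_iff {s : Fin n} (hs : IsExceptional (α s)) :
    SolvesComponent α ℓ σ s ↔ endFunctional α ℓ σ (nextExceptional α s)
      (transport (transfer α ℓ σ) (s + 1) (compSize α s - 1) (xVec (α s))) = 0 := by
  rw [SolvesComponent, componentMatrix, pathMatrix_mulVec, Nat.sub_add_cancel (compSize_spec hs).1]
  rfl

end Transfer

section PositiveMultiplicity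

variable {n : ℕ} [NeZero n] {α ℓ : Fin n → ℝ} {σ : ℝ}

theorem mem_eigenData_iff_amplitude (hσ : σ ≠ 0) {p : Fin n → Fin 2 → ℂ} :
    p ∈ eigenData α ℓ σ ↔ ∀ j, VertexMatching (α j)
      (waveValue (sideMatrix (ℓ j) σ *ᵥ amplitude hσ (p j)))
      (waveSlope (sideMatrix (ℓ j) σ *ᵥ amplitude hσ (p j)))
      (waveValue (amplitude hσ (p (j + 1)))) (waveSlope (amplitude hσ (p (j + 1)))) := by
  have hIσ : Complex.I * σ ≠ 0 := mul_ne_zero Complex.I_ne_zero (mod_cast hσ)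
  rw [mem_eigenData_iff]
  refine forall_congr' fun j => ?_
  rw [← vertexMatching_mul_slope_iff (f₂' := waveSlope _) hIσ,
    I_mul_waveSlope_sideMatrix_amplitude, I_mul_waveSlope_amplitude,
    waveValue_sideMatrix_amplitude, waveValue_amplitude]

theorem eigenData_eq_comap_cyclicSolutions (hα : ∀ j, 0 < α j)
    (hex : ∀ j, ¬IsExceptional (α j)) (hσ : σ ≠ 0) :
    eigenData α ℓ σ = (cyclicSolutions (transfer α ℓ σ)).comap
      (LinearEquiv.piCongrRight fun _ => amplitude hσ).toLinearMap := by
  ext p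
  rw [mem_eigenData_iff_amplitude hσ]
  refine forall_congr' fun j => (vertexMatching_wave_iff (hα j) (hex j)).trans ?_
  rw [← transfer_apply]
  rfl

theorem eigenData_eq_comap_boundarySolutions (hα : ∀ j, 0 < α j) (hσ : σ ≠ 0) :
    eigenData α ℓ σ =
      (boundarySolutions α (transfer α ℓ σ) (fun j => xVec (α j)) (endFunctional α ℓ σ)).comap
        (LinearEquiv.piCongrRight fun _ => amplitude hσ).toLinearMap := by
  ext p
  rw [mem_eigenData_iff_amplitude hσ]
  refine forall_congr' fun j => ?_
  by_cases hj : IsExceptional (α j)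
  · rw [vertexMatching_wave_iff_of_isExceptional (hα j) hj]
    exact ⟨fun h => ⟨absurd hj, fun _ => h⟩, fun h => h.2 hj⟩
  · rw [vertexMatching_wave_iff (hα j) hj, ← transfer_apply]
    exact ⟨fun h => ⟨fun _ => h, fun h' => absurd h' hj⟩, fun h => h.1 hj⟩

theorem isQuasiEigenvalue_iff_of_exists (hex : ∃ j, IsExceptional (α j)) (hσ : 0 ≤ σ) :
    IsQuasiEigenvalue α ℓ σ ↔ ∃ s, IsExceptional (α s) ∧ SolvesComponent α ℓ σ s := by
  rw [IsQuasiEigenvalue, if_pos hex, and_iff_right hσ]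

theorem isQuasiEigenvalue_iff_of_not_exists (hex : ¬∃ j, IsExceptional (α j)) (hσ : 0 ≤ σ) :
    IsQuasiEigenvalue α ℓ σ ↔
      Module.End.HasEigenvalue (toLin' (polygonMatrix α ℓ σ)) 1 := by
  rw [IsQuasiEigenvalue, if_neg hex, and_iff_right hσ]

theorem quasiMultiplicity_eq_ncard (hex : ∃ j, IsExceptional (α j)) (hσ : 0 < σ) :
    quasiMultiplicity α ℓ σ =
      {s : Fin n | IsExceptional (α s) ∧ SolvesComponent α ℓ σ s}.ncard := by
  rw [quasiMultiplicity, if_pos hex, if_neg hσ.ne', isQuasiEigenvalue_iff_of_exists hex hσ.le]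
  split_ifs with h
  · rfl
  · exact ((Set.ncard_eq_zero (Set.toFinite _)).2
      (Set.eq_empty_of_forall_notMem fun s hs => h ⟨s, hs⟩)).symm

theorem quasiMultiplicity_eq_finrank (hex : ¬∃ j, IsExceptional (α j)) (hσ : 0 < σ) :
    quasiMultiplicity α ℓ σ =
      Module.finrank ℂ (Module.End.eigenspace (toLin' (polygonMatrix α ℓ σ)) 1) := by
  rw [quasiMultiplicity, if_neg hex, if_neg hσ.ne', isQuasiEigenvalue_iff_of_not_exists hex hσ.le]
  split_ifs with h
  · rfl
  · rw [Module.End.hasEigenvalue_iff, not_not] at h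
    rw [h, finrank_bot]

theorem finrank_eigenData_of_pos (hα : ∀ j, 0 < α j) (hσ : 0 < σ) :
    Module.finrank ℂ (eigenData α ℓ σ) = quasiMultiplicity α ℓ σ := by
  by_cases hex : ∃ j, IsExceptional (α j)
  · rw [eigenData_eq_comap_boundarySolutions hα hσ.ne', (LinearEquiv.ofSubmodule' _ _).finrank_eq,
      finrank_boundarySolutions hex, quasiMultiplicity_eq_ncard hex hσ]
    congr 1
    ext s
    refine and_congr_right fun hs => ?_
    rw [solvesComponent_iff hs, and_iff_right (xVec_ne_zero _)]
  · rw [eigenData_eq_comap_cyclicSolutions hα (not_exists.1 hex) hσ.ne',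
      (LinearEquiv.ofSubmodule' _ _).finrank_eq, finrank_cyclicSolutions, ← toLin'_polygonMatrix,
      quasiMultiplicity_eq_finrank hex hσ]

end PositiveMultiplicity

section ZeroTransfer

variable {n : ℕ} [NeZero n] {α ℓ : Fin n → ℝ}

theorem sideMatrix_zero (l : ℝ) : sideMatrix l 0 = 1 := by
  simp [sideMatrix, one_fin_two]

/-- The product of the jump factors of the `m` vertices `j, …, j + m - 1`. -/
def jumpProd (α : Fin n → ℝ) (j : Fin n) (m : ℕ) : ℂ :=
  ∏ i ∈ Finset.range m, (jump (α (step j i)) : ℂ)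

theorem jumpProd_succ (α : Fin n → ℝ) (j : Fin n) (m : ℕ) :
    jumpProd α j (m + 1) = jump (α (step j m)) * jumpProd α j m := by
  rw [jumpProd, jumpProd, Finset.prod_range_succ, mul_comm]

theorem waveValue_transport_zero (α ℓ : Fin n → ℝ) (j : Fin n) (m : ℕ) (v : Fin 2 → ℂ) :
    waveValue (transport (transfer α ℓ 0) j m v) = jumpProd α j m * waveValue v := by
  induction m with
  | zero => simp [transport, jumpProd]
  | succ m ih =>
    rw [transport, Module.End.mul_apply, transfer_apply, sideMatrix_zero, one_mulVec,
      waveValue_vertexMatrix, ih, jumpProd_succ, mul_assoc]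

theorem waveSlope_transport_zero (α ℓ : Fin n → ℝ) (j : Fin n) (m : ℕ) (v : Fin 2 → ℂ) :
    waveSlope (transport (transfer α ℓ 0) j m v) = (jumpProd α j m)⁻¹ * waveSlope v := by
  induction m with
  | zero => simp [transport, jumpProd]
  | succ m ih =>
    rw [transport, Module.End.mul_apply, transfer_apply, sideMatrix_zero, one_mulVec,
      waveSlope_vertexMatrix, ih, jumpProd_succ, mul_inv, mul_assoc]

/-- Multiplication by the jump factor of the vertex `j`. -/
def jumpMap (α : Fin n → ℝ) (j : Fin n) : Module.End ℂ ℂ := (jump (α j) : ℂ) • 1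

theorem transport_jumpMap (α : Fin n → ℝ) (j : Fin n) (m : ℕ) :
    transport (jumpMap α) j m = jumpProd α j m • 1 := by
  induction m with
  | zero => simp [transport, jumpProd]
  | succ m ih => rw [transport, ih, jumpMap, smul_mul_smul_comm, one_mul, jumpProd_succ]

theorem jumpProd_component_ne_zero (hα : ∀ j, 0 < α j) (s : Fin n) :
    jumpProd α (s + 1) (compSize α s - 1) ≠ 0 := by
  refine Finset.prod_ne_zero_iff.2 fun i hi => ?_
  rw [step_add_one, Complex.ofReal_ne_zero]
  refine jump_ne_zero (hα _) fun h => ?_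
  have := compSize_le (Nat.le_add_left 1 i) h
  have := Finset.mem_range.1 hi
  omega

/-- Initial data of the functions that are constant on every edge. -/
def edgeConst (n : ℕ) : (Fin n → ℂ) →ₗ[ℂ] Fin n → Fin 2 → ℂ :=
  LinearMap.pi fun j => LinearMap.single ℂ (fun _ => ℂ) 0 ∘ₗ LinearMap.proj j

theorem edgeConst_injective (n : ℕ) : Function.Injective (edgeConst n) := fun _ _ h =>
  funext fun j => congrFun (congrFun h j) 0

theorem mem_comap_edgeConst {p : Fin n → ℂ} : p ∈ (eigenData α ℓ 0).comap (edgeConst n) ↔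
    ∀ j, VertexMatching (α j) (p j) 0 (p (j + 1)) 0 := by
  rw [Submodule.mem_comap, mem_eigenData_iff]
  simp [edgeSol, edgeSolDeriv, edgeConst]

theorem finrank_eigenData_zero (hℓ : ∀ j, 0 < ℓ j) :
    Module.finrank ℂ (eigenData α ℓ 0) =
      Module.finrank ℂ ((eigenData α ℓ 0).comap (edgeConst n)) := by
  have hrange : eigenData α ℓ 0 ≤ LinearMap.range (edgeConst n) := fun p hp =>
    ⟨fun j => p j 0, by
      ext j i
      fin_cases i
      · rfl
      · exact (slope_eq_zero_of_mem_eigenData_zero hℓ hp j).symm⟩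
  have hmap := (Submodule.equivMapOfInjective _ (edgeConst_injective n)
    ((eigenData α ℓ 0).comap (edgeConst n))).finrank_eq
  rwa [Submodule.map_comap_eq_self hrange, eq_comm] at hmap

end ZeroTransfer

section ZeroMultiplicity

variable {n : ℕ} [NeZero n] {α ℓ : Fin n → ℝ}

theorem comap_edgeConst_eq_cyclicSolutions (hα : ∀ j, 0 < α j)
    (hex : ∀ j, ¬IsExceptional (α j)) :
    (eigenData α ℓ 0).comap (edgeConst n) = cyclicSolutions (jumpMap α) := by
  ext p
  rw [mem_comap_edgeConst]
  refine forall_congr' fun j => ?_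
  rw [vertexMatching_iff_of_not_isExceptional (hα j) (hex j), mul_zero, and_iff_left rfl]
  rfl

theorem hasEigenvalue_polygonMatrix_zero :
    Module.End.HasEigenvalue (toLin' (polygonMatrix α ℓ 0)) 1 ↔ jumpProd α 0 n = 1 := by
  rw [toLin'_polygonMatrix]
  constructor
  · intro h
    obtain ⟨v, hv⟩ := h.exists_hasEigenvector
    have hfix := hv.apply_eq_smul
    rw [one_smul] at hfix
    have hvalue := waveValue_transport_zero α ℓ 0 n v
    have hslope := waveSlope_transport_zero α ℓ 0 n v
    rw [hfix, eq_comm, mul_left_eq_self₀] at hvalue hslope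
    rw [inv_eq_one] at hslope
    by_contra hne
    exact hv.2 (wave_ext (by simpa [hne] using hvalue) (by simpa [hne] using hslope))
  · intro h
    refine Module.End.hasEigenvalue_of_hasEigenvector (x := phaseVec 0)
      ⟨?_, phaseVec_ne_zero 0⟩
    rw [Module.End.mem_eigenspace_iff, one_smul]
    apply wave_ext
    · rw [waveValue_transport_zero, h, one_mul]
    · rw [waveSlope_transport_zero, h, inv_one, one_mul]

theorem finrank_eigenspace_smul_one (c : ℂ) :
    Module.finrank ℂ (Module.End.eigenspace (c • 1 : Module.End ℂ ℂ) 1) =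
      open Classical in if c = 1 then 1 else 0 := by
  split_ifs with h
  · have htop : Module.End.eigenspace (c • 1 : Module.End ℂ ℂ) 1 = ⊤ := by
      ext w
      simp [h]
    rw [htop, finrank_top, Module.finrank_self]
  · have hbot : Module.End.eigenspace (c • 1 : Module.End ℂ ℂ) 1 = ⊥ := by
      ext w
      simp [mul_left_eq_self₀, h]
    rw [hbot, finrank_bot]

theorem finrank_eigenData_zero_of_not_exists (hα : ∀ j, 0 < α j) (hℓ : ∀ j, 0 < ℓ j)
    (hex : ¬∃ j, IsExceptional (α j)) :
    Module.finrank ℂ (eigenData α ℓ 0) = quasiMultiplicity α ℓ 0 := by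
  rw [finrank_eigenData_zero hℓ, comap_edgeConst_eq_cyclicSolutions hα (not_exists.1 hex),
    finrank_cyclicSolutions, transport_jumpMap, finrank_eigenspace_smul_one, quasiMultiplicity,
    if_neg hex, if_pos rfl, isQuasiEigenvalue_iff_of_not_exists hex le_rfl,
    hasEigenvalue_polygonMatrix_zero]

theorem waveValue_xVec_eq_zero_iff {a : ℝ} : waveValue (xVec a) = 0 ↔ parity a ≠ 1 := by
  rw [xVec_eq, map_smul, smul_eq_zero, or_iff_right xScalar_ne_zero, waveValue_phaseVec, basePhase]
  split_ifs with h <;> simp [-Complex.ofReal_cos, h]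

theorem waveSlope_xVec_eq_zero_iff {a : ℝ} : waveSlope (xVec a) = 0 ↔ parity a = 1 := by
  rw [xVec_eq, map_smul, smul_eq_zero, or_iff_right xScalar_ne_zero, waveSlope_phaseVec, basePhase]
  split_ifs with h <;> simp [-Complex.ofReal_sin, h]

theorem dotProduct_star_xVec_eq_zero_iff {a : ℝ} {v : Fin 2 → ℂ} : v ⬝ᵥ star (xVec a) = 0 ↔
    (parity a = 1 ∧ waveValue v = 0) ∨ (parity a ≠ 1 ∧ waveSlope v = 0) := by
  rw [xVec]
  split_ifs with h
  · rw [dotProduct_star_xEven_eq_zero_iff]; tauto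
  · rw [dotProduct_star_xOdd_eq_zero_iff]; tauto

theorem parity_ne_parity_iff {a b : ℝ} (ha : 0 < a) (hb : 0 < b) (ha' : IsExceptional a)
    (hb' : IsExceptional b) : parity a ≠ parity b ↔
      (parity a = 1 ∧ parity b ≠ 1) ∨ (parity b = 1 ∧ parity a ≠ 1) := by
  rcases parity_eq_one_or_neg_one ha ha' with ha | ha <;>
  rcases parity_eq_one_or_neg_one hb hb' with hb | hb <;>
  rw [ha, hb] <;> norm_num

theorem solvesComponent_zero_iff (hα : ∀ j, 0 < α j) {s : Fin n} (hs : IsExceptional (α s)) :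
    SolvesComponent α ℓ 0 s ↔ parity (α s) ≠ parity (α (nextExceptional α s)) := by
  have hjump := jumpProd_component_ne_zero hα s
  rw [solvesComponent_iff hs, parity_ne_parity_iff (hα _) (hα _) hs (compSize_spec hs).2]
  change (_ *ᵥ _) ⬝ᵥ star (xVec _) = 0 ↔ _
  rw [sideMatrix_zero, one_mulVec, dotProduct_star_xVec_eq_zero_iff, waveValue_transport_zero,
    waveSlope_transport_zero, mul_eq_zero, or_iff_right hjump, mul_eq_zero,
    or_iff_right (inv_ne_zero hjump), waveValue_xVec_eq_zero_iff, waveSlope_xVec_eq_zero_iff,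
    or_comm, and_comm (b := parity (α s) = 1)]

/-- The exceptional components that lead from an even vertex to an odd one. -/
def evenOddStarts (α : Fin n → ℝ) : Set (Fin n) :=
  {s | IsExceptional (α s) ∧ parity (α s) = 1 ∧ parity (α (nextExceptional α s)) ≠ 1}

/-- The exceptional components that lead from an odd vertex to an even one. -/
def oddEvenStarts (α : Fin n → ℝ) : Set (Fin n) :=
  {s | IsExceptional (α s) ∧ parity (α (nextExceptional α s)) = 1 ∧ parity (α s) ≠ 1}

theorem ncard_oddEvenStarts (α : Fin n → ℝ) :
    (oddEvenStarts α).ncard = (evenOddStarts α).ncard := by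
  set E : Set (Fin n) := {s | IsExceptional (α s) ∧ parity (α s) = 1} with hE
  set F : Set (Fin n) := {s | IsExceptional (α s) ∧ parity (α (nextExceptional α s)) = 1} with hF
  have hcard : F.ncard = E.ncard := by
    refine Set.ncard_congr (fun s _ => nextExceptional α s)
      (fun s hs => ⟨(compSize_spec hs.1).2, hs.2⟩) (fun s t hs ht h => ?_) fun s hs => ?_
    · rw [← prevExceptional_nextExceptional hs.1, h, prevExceptional_nextExceptional ht.1]
    · exact ⟨prevExceptional α s, ⟨(prevDist_spec ⟨s, hs.1⟩ s).2,
        by rw [nextExceptional_prevExceptional hs.1]; exact hs.2⟩,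
        nextExceptional_prevExceptional hs.1⟩
  have hodd : oddEvenStarts α = F \ E := by
    ext s; simp only [oddEvenStarts, hE, hF, Set.mem_ofPred_eq, Set.mem_sdiff]; tauto
  have heven : evenOddStarts α = E \ F := by
    ext s; simp only [evenOddStarts, hE, hF, Set.mem_ofPred_eq, Set.mem_sdiff]; tauto
  rw [hodd, heven, ← Set.ncard_eq_ncard_iff_ncard_sdiff_eq_ncard_sdiff]
  exact hcard

theorem ncard_parity_ne (hα : ∀ j, 0 < α j) :
    {s : Fin n | IsExceptional (α s) ∧ parity (α s) ≠ parity (α (nextExceptional α s))}.ncard =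
      2 * (evenOddStarts α).ncard := by
  have hunion : {s : Fin n | IsExceptional (α s) ∧
      parity (α s) ≠ parity (α (nextExceptional α s))} = evenOddStarts α ∪ oddEvenStarts α := by
    ext s
    refine Iff.trans (and_congr_right fun hs =>
      parity_ne_parity_iff (hα _) (hα _) hs (compSize_spec hs).2) and_or_left
  have hdisjoint : Disjoint (evenOddStarts α) (oddEvenStarts α) :=
    Set.disjoint_left.2 fun s hs hs' => hs'.2.2 hs.2.1
  rw [hunion, Set.ncard_union_eq hdisjoint, ncard_oddEvenStarts, two_mul]

open Classical in
theorem comap_edgeConst_eq_boundarySolutions (hα : ∀ j, 0 < α j) :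
    (eigenData α ℓ 0).comap (edgeConst n) = boundarySolutions α (jumpMap α)
      (fun j => if parity (α j) = 1 then 1 else 0)
      (fun j => if parity (α j) = 1 then LinearMap.id else 0) := by
  ext p
  rw [mem_comap_edgeConst]
  refine forall_congr' fun j => ?_
  by_cases hj : IsExceptional (α j)
  · simp only [hj, not_true_eq_false, false_imp_iff, true_and, forall_const]
    rcases parity_eq_one_or_neg_one (hα j) hj with even | odd
    · rw [vertexMatching_iff_of_parity_eq_one even, and_iff_left rfl, if_pos even, if_pos even]
      exact (and_iff_right (Submodule.mem_span_singleton.2 ⟨p (j + 1), mul_one _⟩)).symm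
    · have hne : parity (α j) ≠ 1 := by rw [odd]; norm_num
      rw [vertexMatching_iff_of_parity_eq_neg_one odd, if_neg hne, if_neg hne,
        Submodule.span_zero_singleton, Submodule.mem_bot]
      exact and_congr_right fun _ => Iff.rfl
  · simp only [hj, not_false_eq_true, forall_const, false_imp_iff, and_true]
    rw [vertexMatching_iff_of_not_isExceptional (hα j) hj, mul_zero, and_iff_left rfl]
    rfl

open Classical in
theorem solvableStarts_jumpMap (hα : ∀ j, 0 < α j) :
    solvableStarts α (jumpMap α) (fun j => if parity (α j) = 1 then 1 else 0)
      (fun j => if parity (α j) = 1 then LinearMap.id else 0) = evenOddStarts α := by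
  ext s
  refine and_congr_right fun _ => ?_
  have hjump := jumpProd_component_ne_zero hα s
  simp only [transport_jumpMap]
  by_cases hstart : parity (α s) = 1 <;>
  by_cases hend : parity (α (nextExceptional α s)) = 1 <;>
  simp [hstart, hend, hjump]

theorem finrank_eigenData_zero_of_exists (hα : ∀ j, 0 < α j) (hℓ : ∀ j, 0 < ℓ j)
    (hex : ∃ j, IsExceptional (α j)) :
    Module.finrank ℂ (eigenData α ℓ 0) = quasiMultiplicity α ℓ 0 := by
  rw [finrank_eigenData_zero hℓ, comap_edgeConst_eq_boundarySolutions hα,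
    finrank_boundarySolutions hex, solvableStarts_jumpMap hα, quasiMultiplicity, if_pos hex,
    if_pos rfl, ncard_parity_ne hα, Nat.mul_div_cancel_left _ two_pos,
    isQuasiEigenvalue_iff_of_exists hex le_rfl]
  split_ifs with h
  · rfl
  · refine (Set.ncard_eq_zero (Set.toFinite _)).2
      (Set.eq_empty_of_forall_notMem fun s hs => h ⟨s, hs.1, ?_⟩)
    rw [solvesComponent_zero_iff hα hs.1, hs.2.1]
    exact hs.2.2.symm

theorem finrank_eigenData (hα : ∀ j, 0 < α j) (hℓ : ∀ j, 0 < ℓ j) {σ : ℝ} (hσ : 0 ≤ σ) :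
    Module.finrank ℂ (eigenData α ℓ σ) = quasiMultiplicity α ℓ σ := by
  rcases hσ.eq_or_lt with rfl | hσ
  · by_cases hex : ∃ j, IsExceptional (α j)
    · exact finrank_eigenData_zero_of_exists hα hℓ hex
    · exact finrank_eigenData_zero_of_not_exists hα hℓ hex
  · exact finrank_eigenData_of_pos hα hσ

end ZeroMultiplicity

/-! ### Phases -/

section Phases

theorem phaseVec_add_nat_mul_two_pi (φ : ℝ) (k : ℕ) :
    phaseVec (φ + k * (2 * Real.pi)) = phaseVec φ := by
  apply wave_ext
  · rw [waveValue_phaseVec, waveValue_phaseVec, Real.cos_add_nat_mul_two_pi]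
  · rw [waveSlope_phaseVec, waveSlope_phaseVec, Real.sin_add_nat_mul_two_pi]

theorem phaseVec_pi : phaseVec Real.pi = -phaseVec 0 := by
  apply wave_ext
  · simp [waveValue_phaseVec, -Complex.ofReal_cos]
  · simp [waveSlope_phaseVec, -Complex.ofReal_sin]

theorem sideMatrix_mulVec_phaseVec (l σ θ : ℝ) :
    sideMatrix l σ *ᵥ phaseVec θ = phaseVec (θ + l * σ) := by
  rw [sideMatrix_mulVec, phaseVec, phaseVec]
  simp only [cons_val_zero, cons_val_one]
  rw [mul_left_comm, ← Complex.exp_add, ← Complex.exp_add]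
  push_cast
  ring_nf

theorem exists_continuous_polar_of_pos {J : ℝ} (hJ : 0 < J) :
    ∃ φ ρ : ℝ → ℝ, Continuous φ ∧ (∀ θ, 0 < ρ θ) ∧ (∀ θ, θ - Real.pi ≤ φ θ) ∧
      ∀ θ, J * Real.cos θ = ρ θ * Real.cos (φ θ) ∧ J⁻¹ * Real.sin θ = ρ θ * Real.sin (φ θ) := by
  -- `q θ = e^{-iθ} (J cos θ + i J⁻¹ sin θ)` stays in the right half-plane, where `arg` is
  -- continuous.
  set q : ℝ → ℂ := fun θ => (J * Real.cos θ ^ 2 + J⁻¹ * Real.sin θ ^ 2 : ℝ) +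
    ((J⁻¹ - J) * (Real.sin θ * Real.cos θ) : ℝ) * Complex.I with hq
  have hq_re (θ) : (q θ).re = J * Real.cos θ ^ 2 + J⁻¹ * Real.sin θ ^ 2 := by
    simp only [hq, Complex.add_re, Complex.ofReal_re, Complex.re_ofReal_mul, Complex.I_re,
      mul_zero, add_zero]
  have hq_im (θ) : (q θ).im = (J⁻¹ - J) * (Real.sin θ * Real.cos θ) := by
    simp only [hq, Complex.add_im, Complex.ofReal_im, Complex.im_ofReal_mul, Complex.I_im,
      mul_one, zero_add]
  have hq_slit (θ) : q θ ∈ Complex.slitPlane := by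
    left
    rw [hq_re]
    rcases eq_or_ne (Real.cos θ) 0 with hcos | hcos
    · rw [hcos, Real.sin_sq, hcos]
      simpa using hJ
    · positivity
  have hq_cont : Continuous q := by fun_prop
  refine ⟨fun θ => θ + (q θ).arg, fun θ => ‖q θ‖, ?_, fun θ => ?_, fun θ => ?_, fun θ => ⟨?_, ?_⟩⟩
  · exact continuous_id.add <| continuous_iff_continuousAt.2 fun θ =>
      (Complex.continuousAt_arg (hq_slit θ)).comp hq_cont.continuousAt
  · exact norm_pos_iff.2 (Complex.slitPlane_ne_zero (hq_slit θ))
  · linarith [Complex.neg_pi_lt_arg (q θ)]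
  · rw [Real.cos_add, mul_sub, mul_left_comm, mul_left_comm _ (Real.sin θ),
      Complex.norm_mul_cos_arg, Complex.norm_mul_sin_arg, hq_re, hq_im]
    linear_combination (-J * Real.cos θ) * Real.sin_sq_add_cos_sq θ
  · rw [Real.sin_add, mul_add, mul_left_comm, mul_left_comm _ (Real.cos θ),
      Complex.norm_mul_cos_arg, Complex.norm_mul_sin_arg, hq_re, hq_im]
    linear_combination (-J⁻¹ * Real.sin θ) * Real.sin_sq_add_cos_sq θ

theorem exists_continuous_polar {J : ℝ} (hJ : J ≠ 0) :
    ∃ φ ρ : ℝ → ℝ, Continuous φ ∧ (∀ θ, 0 < ρ θ) ∧ (∀ θ, θ - Real.pi ≤ φ θ) ∧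
      ∀ θ, J * Real.cos θ = ρ θ * Real.cos (φ θ) ∧ J⁻¹ * Real.sin θ = ρ θ * Real.sin (φ θ) := by
  rcases hJ.lt_or_gt with neg | pos
  · obtain ⟨φ, ρ, hφ, hρ, hle, hpolar⟩ := exists_continuous_polar_of_pos (neg_pos.2 neg)
    refine ⟨fun θ => φ θ + Real.pi, ρ, by fun_prop, hρ, fun θ => ?_, fun θ => ?_⟩
    · linarith [hle θ, Real.pi_pos]
    · rw [Real.cos_add_pi, Real.sin_add_pi, mul_neg, mul_neg, ← (hpolar θ).1, ← (hpolar θ).2]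
      simp [inv_neg]
  · exact exists_continuous_polar_of_pos pos

/-- The vectors `g σ` are positive multiples of `κ • phaseVec (θ σ)` for a continuous phase `θ`
that grows at least with slope `m`. -/
def HasPhase (κ : ℂ) (m : ℝ) (g : ℝ → Fin 2 → ℂ) : Prop :=
  ∃ (θ r : ℝ → ℝ) (C : ℝ), Continuous θ ∧ (∀ σ, 0 < r σ) ∧ (∀ σ, m * σ - C ≤ θ σ) ∧
    ∀ σ, g σ = (κ * r σ) • phaseVec (θ σ)

theorem hasPhase_const (κ : ℂ) (θ : ℝ) : HasPhase κ 0 fun _ => κ • phaseVec θ :=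
  ⟨fun _ => θ, fun _ => 1, -θ, continuous_const, fun _ => one_pos, by simp, by simp⟩

namespace HasPhase

variable {κ : ℂ} {m : ℝ} {g : ℝ → Fin 2 → ℂ}

theorem sideMatrix_mulVec (h : HasPhase κ m g) (l : ℝ) :
    HasPhase κ (m + l) fun σ => sideMatrix l σ *ᵥ g σ := by
  obtain ⟨θ, r, C, hθ, hr, hC, hg⟩ := h
  refine ⟨fun σ => θ σ + l * σ, r, C, by fun_prop, hr, fun σ => by linarith [hC σ], fun σ => ?_⟩
  beta_reduce
  rw [hg, mulVec_smul, sideMatrix_mulVec_phaseVec]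

theorem vertexMatrix_mulVec (h : HasPhase κ m g) {a : ℝ} (ha : 0 < a) (hex : ¬IsExceptional a) :
    HasPhase κ m fun σ => vertexMatrix a *ᵥ g σ := by
  obtain ⟨θ, r, C, hθ, hr, hC, hg⟩ := h
  obtain ⟨φ, ρ, hφ, hρ, hle, hpolar⟩ := exists_continuous_polar (jump_ne_zero ha hex)
  have hvertex (θ) : vertexMatrix a *ᵥ phaseVec θ = (ρ θ : ℂ) • phaseVec (φ θ) := by
    obtain ⟨hcos, hsin⟩ := hpolar θ
    apply wave_ext
    · rw [waveValue_vertexMatrix, map_smul, waveValue_phaseVec, waveValue_phaseVec, smul_eq_mul,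
        mul_left_comm, mul_left_comm _ 2, ← Complex.ofReal_mul, ← Complex.ofReal_mul, hcos]
    · rw [waveSlope_vertexMatrix, map_smul, waveSlope_phaseVec, waveSlope_phaseVec, smul_eq_mul,
        mul_left_comm, mul_left_comm _ (2 * Complex.I), ← Complex.ofReal_inv,
        ← Complex.ofReal_mul, ← Complex.ofReal_mul, hsin]
  refine ⟨fun σ => φ (θ σ), fun σ => r σ * ρ (θ σ), C + Real.pi, by fun_prop,
    fun σ => mul_pos (hr σ) (hρ _), fun σ => ?_, fun σ => ?_⟩
  · linarith [hC σ, hle (θ σ)]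
  · beta_reduce
    rw [hg, mulVec_smul, hvertex, smul_smul, Complex.ofReal_mul, mul_assoc]

theorem exists_gt_eq_smul_phaseVec (h : HasPhase κ m g) (hm : 0 < m) (R φ : ℝ) :
    ∃ σ > R, ∃ r : ℝ, 0 < r ∧ g σ = (κ * r) • phaseVec φ := by
  obtain ⟨θ, r, C, hθ, hr, hC, hg⟩ := h
  obtain ⟨k, hk⟩ := exists_nat_ge ((θ (R + 1) - φ) / (2 * Real.pi))
  set t := φ + k * (2 * Real.pi) with ht
  have ht_ge : θ (R + 1) ≤ t := by
    rw [div_le_iff₀ (by positivity)] at hk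
    linarith
  have ht_le : t ≤ θ (max (R + 1) ((t + C) / m)) := by
    have hmax := (div_le_iff₀ hm).1 (le_max_right (R + 1) ((t + C) / m))
    linarith [hC (max (R + 1) ((t + C) / m))]
  obtain ⟨σ, hσ, hσt⟩ := intermediate_value_Icc (le_max_left _ _) hθ.continuousOn ⟨ht_ge, ht_le⟩
  refine ⟨σ, by linarith [hσ.1], r σ, hr σ, ?_⟩
  rw [hg, hσt, ht, phaseVec_add_nat_mul_two_pi]

end HasPhase

end Phases

/-! ### Analytic dependence on the spectral parameter -/

section Analyticity

theorem finite_setOf_mem_Icc_eq_zero {E : Type*} [NormedAddCommGroup E] [NormedSpace ℝ E]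
    {f : ℝ → E} (hf : ∀ x, AnalyticAt ℝ f x) {y : ℝ} (hy : f y ≠ 0) (a b : ℝ) :
    {x | x ∈ Set.Icc a b ∧ f x = 0}.Finite := by
  by_contra hinf
  obtain ⟨x, -, hx⟩ := Set.Infinite.exists_accPt_of_subset_isCompact hinf
    (isCompact_Icc (a := a) (b := b)) fun x hx => hx.1
  have hf_univ : AnalyticOnNhd ℝ f Set.univ := fun x _ => hf x
  refine hy (hf_univ.eqOn_zero_of_preconnected_of_frequently_eq_zero isPreconnected_univ
    (Set.mem_univ x) ?_ (Set.mem_univ y))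
  exact (accPt_iff_frequently_nhdsNE.1 hx).mono fun _ h => h.2

theorem analyticAt_linearMap_comp {E F : Type*} [NormedAddCommGroup E] [NormedSpace ℂ E]
    [FiniteDimensional ℂ E] [NormedAddCommGroup F] [NormedSpace ℂ F] {g : ℝ → E} {σ : ℝ}
    (f : E →ₗ[ℂ] F) (hg : AnalyticAt ℝ g σ) : AnalyticAt ℝ (fun σ => f (g σ)) σ :=
  ((f.toContinuousLinearMap.restrictScalars ℝ).analyticAt (g σ)).fun_comp hg

theorem analyticAt_sideMatrix_mulVec {g : ℝ → Fin 2 → ℂ} {σ : ℝ} (hg : AnalyticAt ℝ g σ)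
    (l : ℝ) : AnalyticAt ℝ (fun σ => sideMatrix l σ *ᵥ g σ) σ := by
  have hexponent : AnalyticAt ℝ (fun σ : ℝ => Complex.I * l * σ) σ :=
    analyticAt_const.mul (Complex.ofRealCLM.analyticAt σ)
  rw [analyticAt_pi_iff] at hg ⊢
  simp only [sideMatrix_mulVec]
  intro i
  fin_cases i
  · exact ((analyticAt_cexp.restrictScalars).fun_comp hexponent).mul (hg 0)
  · exact ((analyticAt_cexp.restrictScalars).fun_comp hexponent.neg).mul (hg 1)

variable {n : ℕ} [NeZero n]

theorem analyticAt_transport (α ℓ : Fin n → ℝ) (j : Fin n) (m : ℕ) (v : Fin 2 → ℂ) (σ : ℝ) :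
    AnalyticAt ℝ (fun σ => transport (transfer α ℓ σ) j m v) σ := by
  induction m with
  | zero => exact analyticAt_const
  | succ m ih =>
    simp only [transport, Module.End.mul_apply, transfer_apply]
    exact analyticAt_linearMap_comp (toLin' (vertexMatrix (α (step j m))))
      (analyticAt_sideMatrix_mulVec ih _)

theorem analyticAt_trace_polygonMatrix (α ℓ : Fin n → ℝ) (σ : ℝ) :
    AnalyticAt ℝ (fun σ => (polygonMatrix α ℓ σ).trace) σ := by
  have hentry (σ i) : polygonMatrix α ℓ σ i i =
      transport (transfer α ℓ σ) 0 n (Pi.single i 1) i := by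
    rw [← toLin'_polygonMatrix, toLin'_apply, mulVec_single_one]
    rfl
  simp only [trace_fin_two, hentry]
  exact (analyticAt_pi_iff.1 (analyticAt_transport α ℓ 0 n _ σ) 0).add
    (analyticAt_pi_iff.1 (analyticAt_transport α ℓ 0 n _ σ) 1)

end Analyticity

/-! ### Distribution of the quasi-eigenvalues -/

section Components

variable {n : ℕ} [NeZero n] {α ℓ : Fin n → ℝ}

theorem exists_hasPhase_transport {κ : ℂ} {v : Fin 2 → ℂ} {θ : ℝ} (hv : v = κ • phaseVec θ)
    (hα : ∀ j, 0 < α j) (hℓ : ∀ j, 0 < ℓ j) (j : Fin n) {m : ℕ}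
    (hex : ∀ i < m, ¬IsExceptional (α (step j i))) :
    ∃ c ≥ 0, (0 < m → 0 < c) ∧ HasPhase κ c fun σ => transport (transfer α ℓ σ) j m v := by
  induction m with
  | zero => exact ⟨0, le_rfl, fun h => absurd h (lt_irrefl 0), hv ▸ hasPhase_const κ θ⟩
  | succ m ih =>
    obtain ⟨c, hc, -, hphase⟩ := ih fun i hi => hex i (by omega)
    have hpos : 0 < c + ℓ (step j m) := by linarith [hℓ (step j m)]
    refine ⟨c + ℓ (step j m), hpos.le, fun _ => hpos, ?_⟩
    simp only [transport, Module.End.mul_apply, transfer_apply]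
    exact (hphase.sideMatrix_mulVec _).vertexMatrix_mulVec (hα _) (hex m (by omega))

/-- The amplitude vector at the end of the exceptional component that starts at `s`, of the wave
that satisfies the boundary condition at `s`. -/
def componentEnd (α ℓ : Fin n → ℝ) (s : Fin n) (σ : ℝ) : Fin 2 → ℂ :=
  sideMatrix (ℓ (nextExceptional α s)) σ *ᵥ
    transport (transfer α ℓ σ) (s + 1) (compSize α s - 1) (xVec (α s))

theorem solvesComponent_iff_componentEnd {s : Fin n} (hs : IsExceptional (α s)) {σ : ℝ} :
    SolvesComponent α ℓ σ s ↔
      componentEnd α ℓ s σ ⬝ᵥ star (xVec (α (nextExceptional α s))) = 0 :=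
  solvesComponent_iff hs

theorem analyticAt_componentEnd_dotProduct (α ℓ : Fin n → ℝ) (s : Fin n) (w : Fin 2 → ℂ)
    (σ : ℝ) : AnalyticAt ℝ (fun σ => componentEnd α ℓ s σ ⬝ᵥ w) σ := by
  have hend : AnalyticAt ℝ (componentEnd α ℓ s) σ :=
    analyticAt_sideMatrix_mulVec (analyticAt_transport α ℓ _ _ _ σ) _
  rw [analyticAt_pi_iff] at hend
  simp only [dotProduct, Fin.sum_univ_two]
  exact ((hend 0).mul analyticAt_const).add ((hend 1).mul analyticAt_const)

theorem exists_hasPhase_componentEnd (hα : ∀ j, 0 < α j) (hℓ : ∀ j, 0 < ℓ j) (s : Fin n) :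
    ∃ c > 0, HasPhase xScalar c (componentEnd α ℓ s) := by
  obtain ⟨c, hc, -, hphase⟩ := exists_hasPhase_transport (xVec_eq (α s)) hα hℓ (s + 1)
    (m := compSize α s - 1) fun i hi h => by
      rw [step_add_one] at h
      have := compSize_le (by omega) h
      omega
  exact ⟨_, add_pos_of_nonneg_of_pos hc (hℓ _), hphase.sideMatrix_mulVec _⟩

theorem phaseVec_dotProduct_star_xVec_eq_zero_iff {φ a : ℝ} :
    phaseVec φ ⬝ᵥ star (xVec a) = 0 ↔ Real.cos (φ - basePhase a) = 0 := by
  rw [dotProduct_star_xVec_eq_zero_iff, waveValue_phaseVec, waveSlope_phaseVec, basePhase]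
  split_ifs with h <;>
    simp [h, -Complex.ofReal_cos, -Complex.ofReal_sin, Real.cos_sub_pi_div_two]

theorem exists_gt_solvesComponent_iff (hα : ∀ j, 0 < α j) (hℓ : ∀ j, 0 < ℓ j) {s : Fin n}
    (hs : IsExceptional (α s)) (R φ : ℝ) :
    ∃ σ > R, (SolvesComponent α ℓ σ s ↔ Real.cos φ = 0) := by
  obtain ⟨c, hc, hphase⟩ := exists_hasPhase_componentEnd hα hℓ s
  obtain ⟨σ, hσ, r, hr, hend⟩ := hphase.exists_gt_eq_smul_phaseVec hc R
    (φ + basePhase (α (nextExceptional α s)))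
  refine ⟨σ, hσ, ?_⟩
  have hscalar : xScalar * r ≠ 0 := mul_ne_zero xScalar_ne_zero (mod_cast hr.ne')
  rw [solvesComponent_iff_componentEnd hs, hend, smul_dotProduct, smul_eq_zero,
    or_iff_right hscalar, phaseVec_dotProduct_star_xVec_eq_zero_iff, add_sub_cancel_right]

theorem finite_solvesComponent (hα : ∀ j, 0 < α j) (hℓ : ∀ j, 0 < ℓ j) {s : Fin n}
    (hs : IsExceptional (α s)) (a b : ℝ) :
    {σ | σ ∈ Set.Icc a b ∧ SolvesComponent α ℓ σ s}.Finite := by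
  obtain ⟨σ, -, hσ⟩ := exists_gt_solvesComponent_iff hα hℓ hs 0 0
  simp only [solvesComponent_iff_componentEnd hs] at hσ ⊢
  exact finite_setOf_mem_Icc_eq_zero (analyticAt_componentEnd_dotProduct α ℓ s _)
    (mt hσ.1 (by simp)) a b

end Components

section Trace

/-- The monoid of the matrices of `SU(1, 1)`. -/
def su11 : Submonoid (Matrix (Fin 2) (Fin 2) ℂ) where
  carrier := {M | M 1 1 = star (M 0 0) ∧ M 1 0 = star (M 0 1) ∧ M.det = 1}
  one_mem' := by simp
  mul_mem' := by
    rintro M N ⟨hM₁₁, hM₁₀, hM⟩ ⟨hN₁₁, hN₁₀, hN⟩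
    refine ⟨?_, ?_, by rw [det_mul, hM, hN, one_mul]⟩ <;>
    · simp only [mul_apply, Fin.sum_univ_two, hM₁₁, hM₁₀, hN₁₁, hN₁₀, star_add, star_mul',
        star_star]
      ring

theorem sideMatrix_mem_su11 (l σ : ℝ) : sideMatrix l σ ∈ su11 := by
  refine ⟨?_, by simp [sideMatrix], ?_⟩
  · simp [sideMatrix, ← Complex.exp_conj]
  · simp [sideMatrix, det_fin_two, ← Complex.exp_add]

theorem vertexMatrix_mem_su11 {a : ℝ} (ha : 0 < a) (hex : ¬IsExceptional a) :
    vertexMatrix a ∈ su11 := by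
  refine ⟨(Complex.conj_ofReal _).symm, ?_, ?_⟩
  · simp [-Complex.ofReal_div, vertexMatrix]
  have hdet : (vertexMatrix a).det = (jump a * (jump a)⁻¹ : ℝ) := by
    rw [inv_jump_eq, jump_eq, vertexMatrix, det_fin_two_of]
    push_cast
    linear_combination (Complex.cos (angleMu a) / Complex.sin (angleMu a)) ^ 2 * Complex.I_sq
  rw [hdet, mul_inv_cancel₀ (jump_ne_zero ha hex), Complex.ofReal_one]

theorem polygonMatrix_mem_su11 {n : ℕ} {α : Fin n → ℝ} (hα : ∀ j, 0 < α j)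
    (hex : ∀ j, ¬IsExceptional (α j)) (ℓ : Fin n → ℝ) (σ : ℝ) : polygonMatrix α ℓ σ ∈ su11 := by
  refine list_prod_mem fun M hM => ?_
  rw [List.mem_reverse, List.mem_ofFn] at hM
  obtain ⟨j, rfl⟩ := hM
  exact mul_mem (vertexMatrix_mem_su11 (hα j) (hex j)) (sideMatrix_mem_su11 _ _)

variable {M : Matrix (Fin 2) (Fin 2) ℂ}

theorem ofReal_re_trace_of_mem_su11 (hM : M ∈ su11) : (M.trace.re : ℂ) = M.trace := by
  rw [trace_fin_two, hM.1]
  exact Complex.ext (by simp) (by simp)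

theorem hasEigenvalue_iff_of_mem_su11 (hM : M ∈ su11) (x : ℝ) :
    Module.End.HasEigenvalue (toLin' M) (x : ℂ) ↔ x ^ 2 + 1 = M.trace.re * x := by
  rw [Module.End.hasEigenvalue_iff_isRoot_charpoly, charpoly_toLin', charpoly_fin_two, hM.2.2,
    ← ofReal_re_trace_of_mem_su11 hM, ← sub_eq_zero (a := x ^ 2 + 1)]
  simp only [Polynomial.IsRoot, Polynomial.eval_add, Polynomial.eval_sub, Polynomial.eval_mul,
    Polynomial.eval_pow, Polynomial.eval_X, Polynomial.eval_C]
  norm_cast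
  rw [sub_add_eq_add_sub]

theorem hasEigenvalue_one_iff_of_mem_su11 (hM : M ∈ su11) :
    Module.End.HasEigenvalue (toLin' M) 1 ↔ M.trace = 2 := by
  rw [← Complex.ofReal_one, hasEigenvalue_iff_of_mem_su11 hM, ← ofReal_re_trace_of_mem_su11 hM,
    one_pow, one_add_one_eq_two, mul_one, eq_comm, Complex.ofReal_re]
  norm_cast

theorem two_le_re_trace_of_hasEigenvalue (hM : M ∈ su11) {r : ℝ} (hr : 0 < r)
    (h : Module.End.HasEigenvalue (toLin' M) (r : ℂ)) : 2 ≤ M.trace.re := by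
  rw [hasEigenvalue_iff_of_mem_su11 hM] at h
  refine le_of_mul_le_mul_right ?_ hr
  linarith [sq_nonneg (r - 1)]

theorem re_trace_le_neg_two_of_hasEigenvalue (hM : M ∈ su11) {r : ℝ} (hr : 0 < r)
    (h : Module.End.HasEigenvalue (toLin' M) ((-r : ℝ) : ℂ)) : M.trace.re ≤ -2 := by
  rw [hasEigenvalue_iff_of_mem_su11 hM] at h
  refine le_of_mul_le_mul_right ?_ hr
  linarith [sq_nonneg (r - 1)]

variable {n : ℕ} [NeZero n] {α ℓ : Fin n → ℝ}

theorem exists_gt_polygonMatrix_mulVec_phaseVec (hα : ∀ j, 0 < α j) (hℓ : ∀ j, 0 < ℓ j)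
    (hex : ∀ j, ¬IsExceptional (α j)) (R φ : ℝ) :
    ∃ σ > R, ∃ r : ℝ, 0 < r ∧ polygonMatrix α ℓ σ *ᵥ phaseVec 0 = (r : ℂ) • phaseVec φ := by
  obtain ⟨c, -, hc, hphase⟩ := exists_hasPhase_transport (one_smul ℂ (phaseVec 0)).symm hα hℓ 0
    (m := n) fun i _ => hex _
  obtain ⟨σ, hσ, r, hr, h⟩ := hphase.exists_gt_eq_smul_phaseVec (hc (NeZero.pos n)) R φ
  refine ⟨σ, hσ, r, hr, ?_⟩
  rwa [one_mul, ← toLin'_polygonMatrix, toLin'_apply] at h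

theorem hasEigenvalue_of_mulVec_phaseVec {c : ℂ} {θ : ℝ}
    (h : M *ᵥ phaseVec θ = c • phaseVec θ) : Module.End.HasEigenvalue (toLin' M) c :=
  Module.End.hasEigenvalue_of_hasEigenvector
    ⟨Module.End.mem_eigenspace_iff.2 h, phaseVec_ne_zero θ⟩

theorem exists_gt_two_le_re_trace (hα : ∀ j, 0 < α j) (hℓ : ∀ j, 0 < ℓ j)
    (hex : ∀ j, ¬IsExceptional (α j)) (R : ℝ) :
    ∃ σ > R, 2 ≤ (polygonMatrix α ℓ σ).trace.re := by
  obtain ⟨σ, hσ, r, hr, h⟩ := exists_gt_polygonMatrix_mulVec_phaseVec hα hℓ hex R 0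
  exact ⟨σ, hσ, two_le_re_trace_of_hasEigenvalue (polygonMatrix_mem_su11 hα hex ℓ σ) hr
    (hasEigenvalue_of_mulVec_phaseVec h)⟩

theorem exists_gt_re_trace_le_neg_two (hα : ∀ j, 0 < α j) (hℓ : ∀ j, 0 < ℓ j)
    (hex : ∀ j, ¬IsExceptional (α j)) (R : ℝ) :
    ∃ σ > R, (polygonMatrix α ℓ σ).trace.re ≤ -2 := by
  obtain ⟨σ, hσ, r, hr, h⟩ := exists_gt_polygonMatrix_mulVec_phaseVec hα hℓ hex R Real.pi
  refine ⟨σ, hσ, re_trace_le_neg_two_of_hasEigenvalue (polygonMatrix_mem_su11 hα hex ℓ σ) hr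
    (hasEigenvalue_of_mulVec_phaseVec (θ := 0) ?_)⟩
  rw [h, phaseVec_pi, smul_neg, Complex.ofReal_neg, neg_smul]

theorem exists_gt_trace_eq_two (hα : ∀ j, 0 < α j) (hℓ : ∀ j, 0 < ℓ j)
    (hex : ∀ j, ¬IsExceptional (α j)) (R : ℝ) :
    ∃ σ > R, (polygonMatrix α ℓ σ).trace = 2 := by
  have hcont : Continuous fun σ => (polygonMatrix α ℓ σ).trace.re :=
    Complex.continuous_re.comp <| continuous_iff_continuousAt.2 fun σ =>
      (analyticAt_trace_polygonMatrix α ℓ σ).continuousAt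
  obtain ⟨σ₁, hσ₁, hlow⟩ := exists_gt_re_trace_le_neg_two hα hℓ hex R
  obtain ⟨σ₂, hσ₂, hhigh⟩ := exists_gt_two_le_re_trace hα hℓ hex σ₁
  obtain ⟨σ, hσ, htrace⟩ := intermediate_value_Icc hσ₂.le hcont.continuousOn
    (show (2 : ℝ) ∈ _ from ⟨by linarith, hhigh⟩)
  refine ⟨σ, hσ₁.trans_le hσ.1, ?_⟩
  rw [← ofReal_re_trace_of_mem_su11 (polygonMatrix_mem_su11 hα hex ℓ σ),
    show (polygonMatrix α ℓ σ).trace.re = 2 from htrace, Complex.ofReal_ofNat]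

theorem finite_trace_eq_two (hα : ∀ j, 0 < α j) (hℓ : ∀ j, 0 < ℓ j)
    (hex : ∀ j, ¬IsExceptional (α j)) (a b : ℝ) :
    {σ | σ ∈ Set.Icc a b ∧ (polygonMatrix α ℓ σ).trace = 2}.Finite := by
  obtain ⟨σ, -, hσ⟩ := exists_gt_re_trace_le_neg_two hα hℓ hex 0
  have hne : (polygonMatrix α ℓ σ).trace - 2 ≠ 0 := fun h => by
    rw [sub_eq_zero.1 h, Complex.re_ofNat] at hσ
    norm_num at hσ
  simp only [← sub_eq_zero (b := (2 : ℂ))]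
  exact finite_setOf_mem_Icc_eq_zero
    (fun x => (analyticAt_trace_polygonMatrix α ℓ x).fun_sub analyticAt_const) hne a b

end Trace

section Distribution

variable {n : ℕ} [NeZero n] {α ℓ : Fin n → ℝ}

theorem exists_isQuasiEigenvalue_gt (hα : ∀ j, 0 < α j) (hℓ : ∀ j, 0 < ℓ j) (R : ℝ) :
    ∃ σ > R, IsQuasiEigenvalue α ℓ σ := by
  by_cases hex : ∃ j, IsExceptional (α j)
  · obtain ⟨s, hs⟩ := hex
    obtain ⟨σ, hσ, h⟩ := exists_gt_solvesComponent_iff hα hℓ hs (max R 0) (Real.pi / 2)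
    obtain ⟨hR, h0⟩ := max_lt_iff.1 hσ
    exact ⟨σ, hR, (isQuasiEigenvalue_iff_of_exists ⟨s, hs⟩ h0.le).2
      ⟨s, hs, h.2 Real.cos_pi_div_two⟩⟩
  · obtain ⟨σ, hσ, h⟩ := exists_gt_trace_eq_two hα hℓ (not_exists.1 hex) (max R 0)
    obtain ⟨hR, h0⟩ := max_lt_iff.1 hσ
    exact ⟨σ, hR, (isQuasiEigenvalue_iff_of_not_exists hex h0.le).2 <|
      (hasEigenvalue_one_iff_of_mem_su11
        (polygonMatrix_mem_su11 hα (not_exists.1 hex) ℓ σ)).2 h⟩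

theorem finite_isQuasiEigenvalue_le (hα : ∀ j, 0 < α j) (hℓ : ∀ j, 0 < ℓ j) (R : ℝ) :
    {σ | IsQuasiEigenvalue α ℓ σ ∧ σ ≤ R}.Finite := by
  by_cases hex : ∃ j, IsExceptional (α j)
  · have hfinite := (Set.toFinite {s | IsExceptional (α s)}).biUnion fun s hs =>
      finite_solvesComponent hα hℓ hs 0 R
    refine hfinite.subset ?_
    rintro σ ⟨hσ, hR⟩
    obtain ⟨s, hs, h⟩ := (isQuasiEigenvalue_iff_of_exists hex hσ.1).1 hσ
    exact Set.mem_biUnion hs ⟨⟨hσ.1, hR⟩, h⟩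
  · refine (finite_trace_eq_two hα hℓ (not_exists.1 hex) 0 R).subset ?_
    rintro σ ⟨hσ, hR⟩
    exact ⟨⟨hσ.1, hR⟩, (hasEigenvalue_one_iff_of_mem_su11
      (polygonMatrix_mem_su11 hα (not_exists.1 hex) ℓ σ)).1 <|
        (isQuasiEigenvalue_iff_of_not_exists hex hσ.1).1 hσ⟩

theorem quasiMultiplicity_pos {σ : ℝ} (hσ : 0 < σ) (h : IsQuasiEigenvalue α ℓ σ) :
    0 < quasiMultiplicity α ℓ σ := by
  by_cases hex : ∃ j, IsExceptional (α j)
  · rw [quasiMultiplicity_eq_ncard hex hσ, Set.ncard_pos]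
    exact (isQuasiEigenvalue_iff_of_exists hex hσ.le).1 h
  · rw [quasiMultiplicity_eq_finrank hex hσ, Module.finrank_pos_iff,
      Submodule.nontrivial_iff_ne_bot]
    exact Module.End.hasEigenvalue_iff.1 ((isQuasiEigenvalue_iff_of_not_exists hex hσ.le).1 h)

theorem quasiMultiplicity_eq_zero {σ : ℝ} (h : ¬IsQuasiEigenvalue α ℓ σ) :
    quasiMultiplicity α ℓ σ = 0 := by
  rw [quasiMultiplicity, if_neg h]

end Distribution

/-! ### Comparison of the two spectra -/

section Spectrum

variable {n : ℕ} [NeZero n] {α ℓ : Fin n → ℝ} {σ : ℕ → ℝ}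

theorem nonneg_of_isQuasiEigenvalueSeq (h : IsQuasiEigenvalueSeq α ℓ σ) (m : ℕ) : 0 ≤ σ m := by
  by_contra hneg
  have hempty := h.2 (σ m)
  rw [quasiMultiplicity_eq_zero fun hq => hneg hq.1, Nat.cast_zero, Set.encard_eq_zero] at hempty
  exact Set.notMem_empty m (hempty ▸ (rfl : σ m = σ m))

theorem isEigenvalueSeq_sq (hα : ∀ j, 0 < α j) (hℓ : ∀ j, 0 < ℓ j)
    (h : IsQuasiEigenvalueSeq α ℓ σ) :
    IsEigenvalueSeq (graphLaplacian α ℓ) fun m => σ m ^ 2 := by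
  have hσ := nonneg_of_isQuasiEigenvalueSeq h
  refine ⟨fun a b hab => pow_le_pow_left₀ (hσ a) (h.1 hab) 2, fun z => ?_⟩
  by_cases hz : ∃ x : ℝ, 0 ≤ x ∧ z = (x : ℂ) ^ 2
  · obtain ⟨x, hx, rfl⟩ := hz
    rw [toENat_rank_eigenspace hℓ, finrank_eigenData hα hℓ hx, ← h.2 x]
    congr 1
    ext m
    rw [Set.mem_ofPred_eq, Set.mem_ofPred_eq, ← Complex.ofReal_pow, Complex.ofReal_inj]
    exact pow_left_inj₀ (hσ m) hx two_ne_zero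
  · push Not at hz
    rw [eigenspace_eq_bot hℓ hz, rank_bot, map_zero, Set.encard_eq_zero]
    refine Set.eq_empty_of_forall_notMem fun m hm => hz (σ m) (hσ m) ?_
    rw [← (show ((σ m ^ 2 : ℝ) : ℂ) = z from hm), Complex.ofReal_pow]

theorem exists_isQuasiEigenvalueSeq (hα : ∀ j, 0 < α j) (hℓ : ∀ j, 0 < ℓ j) :
    ∃ σ : ℕ → ℝ, IsQuasiEigenvalueSeq α ℓ σ ∧ Filter.Tendsto σ Filter.atTop Filter.atTop := by
  have hfinite (R : ℝ) : {x | quasiMultiplicity α ℓ x ≠ 0 ∧ x ≤ R}.Finite :=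
    (finite_isQuasiEigenvalue_le hα hℓ R).subset fun x hx =>
      ⟨not_not.1 (mt quasiMultiplicity_eq_zero hx.1), hx.2⟩
  have hunbounded (R : ℝ) : ∃ x > R, quasiMultiplicity α ℓ x ≠ 0 := by
    obtain ⟨x, hx, hq⟩ := exists_isQuasiEigenvalue_gt hα hℓ (max R 0)
    obtain ⟨hR, h0⟩ := max_lt_iff.1 hx
    exact ⟨x, hR, (quasiMultiplicity_pos h0 hq).ne'⟩
  obtain ⟨σ, hmono, hcard, hlim⟩ := exists_monotone_encard_eq hfinite hunbounded
  exact ⟨σ, ⟨hmono, hcard⟩, hlim⟩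

end Spectrum

end SteklovPolygon

end

theorem mainTheorem3_general {n : ℕ} [NeZero n] (α ℓ : Fin n → ℝ)
    (hα : ∀ j, 0 < α j) (hℓ : ∀ j, 0 < ℓ j) :
    (∃ σ : ℕ → ℝ, SteklovPolygon.IsQuasiEigenvalueSeq α ℓ σ) ∧
    (∃ ν : ℕ → ℝ, SteklovPolygon.IsEigenvalueSeq (SteklovPolygon.graphLaplacian α ℓ) ν ∧
      Filter.Tendsto ν Filter.atTop Filter.atTop) ∧
    ∀ σ ν : ℕ → ℝ, SteklovPolygon.IsQuasiEigenvalueSeq α ℓ σ →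
      SteklovPolygon.IsEigenvalueSeq (SteklovPolygon.graphLaplacian α ℓ) ν →
      ∀ m, σ m ^ 2 = ν m := by
  obtain ⟨σ, hσ, hlim⟩ := SteklovPolygon.exists_isQuasiEigenvalueSeq hα hℓ
  refine ⟨⟨σ, hσ⟩, ⟨fun m => σ m ^ 2, SteklovPolygon.isEigenvalueSeq_sq hα hℓ hσ,
    (Filter.tendsto_pow_atTop two_ne_zero).comp hlim⟩, fun σ ν hσ hν m => ?_⟩
  have hsq := SteklovPolygon.isEigenvalueSeq_sq hα hℓ hσ
  refine congrFun (SteklovPolygon.eq_of_monotone_of_encard_eq hsq.1 hν.1 fun x => ?_) m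
  have hcard := (hsq.2 x).trans (hν.2 x).symm
  simpa only [Complex.ofReal_inj] using hcard

theorem mainTheorem3 {n : ℕ} [NeZero n] (α ℓ : Fin n → ℝ)
    (hα : ∀ j, α j ∈ Set.Ioo 0 Real.pi) (hℓ : ∀ j, 0 < ℓ j) :
    (∃ σ : ℕ → ℝ, SteklovPolygon.IsQuasiEigenvalueSeq α ℓ σ) ∧
    (∃ ν : ℕ → ℝ, SteklovPolygon.IsEigenvalueSeq (SteklovPolygon.graphLaplacian α ℓ) ν ∧
      Filter.Tendsto ν Filter.atTop Filter.atTop) ∧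
    ∀ σ ν : ℕ → ℝ, SteklovPolygon.IsQuasiEigenvalueSeq α ℓ σ →
      SteklovPolygon.IsEigenvalueSeq (SteklovPolygon.graphLaplacian α ℓ) ν →
      ∀ m, σ m ^ 2 = ν m := by
  exact mainTheorem3_general α ℓ (fun j => (hα j).1) hℓ
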